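/- Let $k\ge 1$ and let $f\in\mathbb Z[X]$ be a monic polynomial with $f=g_1\cdots g_k$, where $g_1,\dots,g_k\in\mathbb Z[X]$ are monic, irreducible and pairwise distinct. Put $Z_f=\mathbb Z[X]/(f)$ and define its ideal zeta function by $$\zeta(Z_f,s)=\sum_{I}\,|Z_f/I|^{-s},$$ where $I$ runs over the ideals of finite index of $Z_f$. Then: 1. The series $\zeta(Z_f,s)$ converges absolutely for every $s\in\mathbb C$ with $\operatorname{Re}(s)>1$. 2. There is a meromorphic function on the half-plane $\{s\in\mathbb C:\operatorname{Re}(s)>0\}$ that equals $\zeta(Z_f,s)$ for $\operatorname{Re}(s)>1$ and has a pole of order exactly $k$ at $s=1$. 3. For every $n\ge 1$ the number $a_n(Z_f)$ of ideals of index $n$ in $Z_f$ is finite, and there is a constant $c>0$ (depending on $f$) such that $A_N(Z_f)=\sum_{n=1}^{N}a_n(Z_f)$, the number of ideals of index at most $N$, satisfies $$A_N(Z_f)\sim c\,N(\log N)^{k-1}\qquad (N\to\infty,\ N\in\mathbb N).$$ -/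

import Mathlib

open Polynomial

/-- The index `ν(I) = |R / I|` of an ideal. `Nat.card` gives `0` when the quotient is infinite, so
`idealIndex I ≠ 0` exactly when `I` has finite index. -/
noncomputable def idealIndex {R : Type*} [CommRing R] (I : Ideal R) : ℕ :=
  Nat.card (R ⧸ I)

/-- The ideals of finite index of a commutative ring. -/
def FiniteIndexIdeal (R : Type*) [CommRing R] : Type _ :=
  {I : Ideal R // Finite (R ⧸ I)}

/-- The summand `ν(I) ^ (-s)` of the ideal zeta function, for an ideal `I` of finite index. -/
noncomputable def idealZetaTerm (R : Type*) [CommRing R] (s : ℂ) (I : FiniteIndexIdeal R) : ℂ :=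
  (idealIndex I.1 : ℂ) ^ (-s)

/-- The ideal zeta function `ζ(R, s) = ∑ ν(I) ^ (-s)`, summed over the ideals of finite index. -/
noncomputable def idealZeta (R : Type*) [CommRing R] (s : ℂ) : ℂ :=
  ∑' I : FiniteIndexIdeal R, idealZetaTerm R s I

/-- The set of ideals of index exactly `n` (used for `n ≥ 1`). -/
def idealsOfIndex (R : Type*) [CommRing R] (n : ℕ) : Set (Ideal R) :=
  {I | idealIndex I = n}

/-- The number `a_n(R)` of ideals of index `n`, for `n ≥ 1`. -/
noncomputable def idealCount (R : Type*) [CommRing R] (n : ℕ) : ℕ :=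
  (idealsOfIndex R n).ncard

/-- The number `A_N(R) = ∑_{n ≤ N} a_n(R)` of ideals of index at most `N`. -/
noncomputable def idealCountLE (R : Type*) [CommRing R] (N : ℕ) : ℕ :=
  ∑ n ∈ Finset.Icc 1 N, idealCount R n

/-! Put `R = ℤ[X]/(f)`, `K_i = ℚ[X]/(g_i)` and let `O` be the product of the rings of integers of
the `K_i`. Since the `g_i` are distinct, `R` embeds in `O`, with finite index `m` because both have
rank `deg f`; in particular `m O ⊆ R`. Every ideal of finite index in `R` is uniquely an
intersection of one containing a power of `m` and one coprime to `m`, with multiplicative indices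
(`smoothCoprimeEquiv`), so the zeta function is a product of two.

Contraction matches the coprime ideals of `O` and of `R` and preserves the index
(`coprimeIdealsEquiv`). The coprime factor is therefore the product of the Dedekind zeta functions
of the `K_i` with finitely many Euler factors removed: `k` simple poles at `1`. The other factor
converges for `Re s > 0` and is positive at `1`: in `O` only finitely many primes lie over `m`, and
an ideal `I` of `R` is pinned down by `IO` together with a subset of `IO / m IO`
(`IsNormNegligible.smoothIdeals_of_injective`). So it changes neither the pole order nor the shape
of the asymptotics.

The continuation of a Dedekind zeta function is proved by an analogue of `(1 - 2^(1-s)) ζ(s) = ∑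
(-1)^(n-1) n^(-s)`. Each ideal class contributes a sum over a lattice; a smooth partition of unity
over the unit group replaces the fundamental cone, so that the summand is smooth and homogeneous
away from `0`. Twisting by nontrivial sign characters of the lattice and summing by parts gives
convergence for `Re s > 0` (`IsHomogeneousFamily.exists_meromorphicOn_tsum`). The class number
formula shows that the pole is simple.

The asymptotics need no Tauberian theorem. The linear count of ideals in each `K_i` is carried
through removal of Euler factors, products (`tendsto_normCount_prod`) and negligible factors
(`tendsto_normCount_prod_of_summable`). `HasZetaPole` carries the analytic and the counting
statements together. -/

open scoped ContDiff

universe u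

/-! ### Forward differences of smooth functions. -/

section ForwardDifference

open scoped fwdDiff

/-- Differentiation commutes with iterated forward differences. -/
theorem hasFDerivAt_fwdDiff_iter {E F : Type*} [NormedAddCommGroup E] [NormedSpace ℝ E]
    [NormedAddCommGroup F] [NormedSpace ℝ F] (G : E → F) (w : E) (M : ℕ) (y : E)
    (h : ∀ k : ℕ, k ≤ M → DifferentiableAt ℝ G (y + k • w)) :
    HasFDerivAt ((fwdDiff w)^[M] G) ((fwdDiff w)^[M] (fderiv ℝ G) y) y := by
  have e1 : (fwdDiff w)^[M] G = fun y ↦ ∑ k ∈ Finset.range (M + 1),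
      ((-1 : ℤ) ^ (M - k) * M.choose k) • G (y + k • w) := by
    ext y; exact fwdDiff_iter_eq_sum_shift w G M y
  rw [e1, fwdDiff_iter_eq_sum_shift]
  refine HasFDerivAt.fun_sum fun k hk ↦ ?_
  have hd := (h k (Nat.lt_succ_iff.1 (Finset.mem_range.1 hk))).hasFDerivAt
  have := (hasFDerivAt_comp_add_right (f := G) (x := y) (k • w)).2 hd
  simpa [← Int.cast_smul_eq_zsmul ℝ] using
    this.fun_const_smul ((((-1 : ℤ) ^ (M - k) * M.choose k : ℤ) : ℝ))

/-- On a compact subset of an open set where `G` is smooth, the `M`-th forward difference of `G`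
with step `w` is `O(‖w‖ ^ M)`. -/
theorem exists_norm_fwdDiff_iter_le {E : Type u} [NormedAddCommGroup E] [NormedSpace ℝ E]
    {U K : Set E} (hU : IsOpen U) (hK : IsCompact K) (hKU : K ⊆ U) (M : ℕ) :
    ∀ {F : Type u} [NormedAddCommGroup F] [NormedSpace ℝ F] (G : E → F), ContDiffOn ℝ ∞ G U →
      ∃ C : ℝ, 0 ≤ C ∧ ∀ z w : E, (∀ t ∈ Set.Icc (0 : ℝ) M, z + t • w ∈ K) →
        ‖(fwdDiff w)^[M] G z‖ ≤ C * ‖w‖ ^ M := by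
  induction M with
  | zero =>
    intro F _ _ G hG
    obtain ⟨C, hC⟩ := hK.exists_bound_of_continuousOn (hG.continuousOn.mono hKU)
    refine ⟨max C 0, le_max_right _ _, fun z w h ↦ ?_⟩
    have hz : z ∈ K := by simpa using h 0 (by simp)
    simpa using Or.inl (hC z hz)
  | succ M ih =>
    intro F _ _ G hG
    -- The induction passes to the derivative, whose values lie in another space; hence `F` is
    -- quantified after `M`. The mean value inequality along `t ↦ z + t • w` then supplies one more
    -- factor `‖w‖`.
    obtain ⟨C, hC0, hC⟩ := ih (fderiv ℝ G) (hG.fderiv_of_isOpen hU (m := ∞) (by simp))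
    refine ⟨C, hC0, fun z w h ↦ ?_⟩
    have hmem : ∀ t ∈ Set.Icc (0 : ℝ) 1, ∀ r ∈ Set.Icc (0 : ℝ) M, z + t • w + r • w ∈ K := by
      intro t ht r hr
      have := h (t + r) ⟨add_nonneg ht.1 hr.1, by push_cast; linarith [ht.2, hr.2]⟩
      rwa [add_smul, ← add_assoc] at this
    have hder : ∀ t ∈ Set.Icc (0 : ℝ) 1, HasDerivWithinAt
        (fun t : ℝ ↦ (fwdDiff w)^[M] G (z + t • w))
        ((fwdDiff w)^[M] (fderiv ℝ G) (z + t • w) w) (Set.Icc (0 : ℝ) 1) t := by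
      intro t ht
      have h1 := hasFDerivAt_fwdDiff_iter G w M (z + t • w) (fun k hk ↦ by
        have h2 : z + t • w + (k : ℝ) • w ∈ K := hmem t ht k ⟨by positivity, by exact_mod_cast hk⟩
        rw [Nat.cast_smul_eq_nsmul] at h2
        exact (hG.contDiffAt (hU.mem_nhds (hKU h2))).differentiableAt (by simp))
      have h2 : HasDerivAt (fun t : ℝ ↦ z + t • w) w t := by
        simpa using ((hasDerivAt_id t).smul_const w).const_add z
      exact (h1.comp_hasDerivAt t h2).hasDerivWithinAt
    have hb := norm_image_sub_le_of_norm_deriv_le_segment_01' (C := C * ‖w‖ ^ (M + 1)) hder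
      (fun t ht ↦ by
        refine (ContinuousLinearMap.le_opNorm _ _).trans ?_
        rw [pow_succ, ← mul_assoc]
        gcongr
        exact hC _ _ (hmem t ⟨ht.1, ht.2.le⟩))
    rw [Function.iterate_succ']
    simpa [fwdDiff] using hb

end ForwardDifference

/-! ### Homogeneous families, lattice points and sign characters. -/

section HomogeneousSums

open scoped fwdDiff Topology

/-- A family `G s` of functions on `E` which is smooth away from the origin, homogeneous of degree
`-d * s` and holomorphic in `s`. -/
structure IsHomogeneousFamily {E : Type u} [NormedAddCommGroup E] [NormedSpace ℝ E]
    (G : ℂ → E → ℂ) (d : ℕ) : Prop where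
  contDiffOn : ContDiffOn ℝ ∞ (fun p : ℂ × E ↦ G p.1 p.2) (Set.univ ×ˢ {0}ᶜ)
  smul : ∀ (s : ℂ) (x : E) (t : ℝ), 0 < t → G s (t • x) = (t : ℂ) ^ (-(d * s)) * G s x
  differentiable : ∀ x, Differentiable ℂ fun s ↦ G s x
  map_zero : ∀ s, G s 0 = 0

theorem fwdDiff_iter_smul_apply {E : Type u} [NormedAddCommGroup E] [NormedSpace ℝ E]
    {G : ℂ → E → ℂ} {d : ℕ} (hG : IsHomogeneousFamily G d) (s : ℂ) (v x : E) {t : ℝ} (ht : 0 < t)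
    (M : ℕ) : (fwdDiff (t • v))^[M] (G s) (t • x) =
      (t : ℂ) ^ (-(d * s)) * (fwdDiff v)^[M] (G s) x := by
  rw [fwdDiff_iter_eq_sum_shift, fwdDiff_iter_eq_sum_shift, Finset.mul_sum]
  refine Finset.sum_congr rfl fun k _ ↦ ?_
  rw [smul_comm k t v, ← smul_add, hG.smul s _ t ht, mul_smul_comm]

theorem fwdDiff_iter_prod_apply {A E : Type*} [AddCommGroup A] [AddCommGroup E]
    (G : A → E → ℂ) (s : A) (v x : E) (M : ℕ) :
    (fwdDiff ((0 : A), v))^[M] (fun p : A × E ↦ G p.1 p.2) (s, x) = (fwdDiff v)^[M] (G s) x := by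
  simp [fwdDiff_iter_eq_sum_shift]

/-- Homogeneity moves `x` to the unit sphere, where the step becomes `v / ‖x‖`. The bound on a
compact annulus then gains a factor `‖x‖⁻¹` for each difference. -/
theorem IsHomogeneousFamily.exists_norm_fwdDiff_iter_le {E : Type} [NormedAddCommGroup E]
    [NormedSpace ℝ E] [FiniteDimensional ℝ E] {G : ℂ → E → ℂ} {d : ℕ}
    (hG : IsHomogeneousFamily G d) {K : Set ℂ} (hK : IsCompact K) (v : E) (M : ℕ) :
    ∃ C R : ℝ, 0 ≤ C ∧ 1 ≤ R ∧ ∀ s ∈ K, ∀ x : E, R ≤ ‖x‖ →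
      ‖(fwdDiff v)^[M] (G s) x‖ ≤ C * ‖x‖ ^ (-(d * s.re) - M) := by
  set A : Set E := Metric.closedBall 0 2 \ Metric.ball 0 (1 / 2) with hA
  have hAc : IsCompact A := (isCompact_closedBall _ _).diff Metric.isOpen_ball
  have hsub : K ×ˢ A ⊆ (Set.univ : Set ℂ) ×ˢ ({0}ᶜ : Set E) := by
    rintro ⟨s, x⟩ ⟨-, hx⟩
    refine ⟨trivial, ?_⟩
    rintro rfl
    simp [hA] at hx
  -- Working on `ℂ × E` with steps `(0, w)` makes the constant uniform in `s ∈ K`.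
  obtain ⟨C, hC0, hC⟩ := _root_.exists_norm_fwdDiff_iter_le
    (isOpen_univ.prod isOpen_compl_singleton) (hK.prod hAc) hsub M _ hG.contDiffOn
  -- For `‖x‖ ≥ 2 M ‖v‖` the rescaled segment has length at most `1/2`, so it stays inside the
  -- annulus.
  refine ⟨C * ‖v‖ ^ M, max 1 (2 * (M * ‖v‖)), by positivity, le_max_left _ _, fun s hs x hx ↦ ?_⟩
  have hx1 : 0 < ‖x‖ := lt_of_lt_of_le one_pos ((le_max_left _ _).trans hx)
  have hx2 : M * ‖v‖ ≤ ‖x‖ / 2 := by linarith [(le_max_right _ _).trans hx]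
  have key := hC (s, ‖x‖⁻¹ • x) (0, ‖x‖⁻¹ • v) (by
    intro t ht
    refine ⟨by simpa using hs, ?_⟩
    have hn : ‖‖x‖⁻¹ • x‖ = 1 := by rw [norm_smul, norm_inv, norm_norm, inv_mul_cancel₀ hx1.ne']
    have hw : ‖t • ‖x‖⁻¹ • v‖ ≤ 1 / 2 := by
      rw [norm_smul, norm_smul, norm_inv, norm_norm, Real.norm_of_nonneg ht.1]
      calc t * (‖x‖⁻¹ * ‖v‖) ≤ M * (‖x‖⁻¹ * ‖v‖) := by gcongr; exact ht.2
        _ = ‖x‖⁻¹ * (M * ‖v‖) := by ring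
        _ ≤ ‖x‖⁻¹ * (‖x‖ / 2) := by gcongr
        _ = 1 / 2 := by field_simp
    simp only [hA, Prod.snd_add, Prod.smul_snd, Set.mem_sdiff, Metric.mem_closedBall,
      dist_zero_right, Metric.mem_ball, not_lt]
    constructor
    · linarith [norm_add_le (‖x‖⁻¹ • x) (t • ‖x‖⁻¹ • v)]
    · have := norm_sub_le (‖x‖⁻¹ • x + t • ‖x‖⁻¹ • v) (t • ‖x‖⁻¹ • v)
      rw [add_sub_cancel_right] at this
      linarith)
  rw [fwdDiff_iter_prod_apply] at key
  have h1 := fwdDiff_iter_smul_apply hG s (‖x‖⁻¹ • v) (‖x‖⁻¹ • x) hx1 M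
  rw [smul_inv_smul₀ hx1.ne', smul_inv_smul₀ hx1.ne'] at h1
  rw [h1, norm_mul, Complex.norm_cpow_eq_rpow_re_of_pos hx1]
  have hre : (-((d : ℂ) * s)).re = -(d * s.re) := by simp
  have hnorm : ‖((0 : ℂ), ‖x‖⁻¹ • v)‖ = ‖x‖⁻¹ * ‖v‖ := by
    rw [Prod.norm_def, norm_zero, norm_smul, norm_inv, norm_norm]
    exact max_eq_right (by positivity)
  rw [hre]
  rw [hnorm] at key
  calc ‖x‖ ^ (-(d * s.re)) * ‖(fwdDiff (‖x‖⁻¹ • v))^[M] (G s) (‖x‖⁻¹ • x)‖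
      ≤ ‖x‖ ^ (-(d * s.re)) * (C * (‖x‖⁻¹ * ‖v‖) ^ M) := by gcongr
    _ = C * ‖v‖ ^ M * ‖x‖ ^ (-(d * s.re) - M) := by
      rw [Real.rpow_sub hx1, Real.rpow_natCast, mul_pow, inv_pow]
      field_simp

/-- The lattice point with integral coordinates `x`. -/
noncomputable def latticePoint {ι E : Type*} [Fintype ι] [AddCommGroup E] [Module ℝ E]
    (b : Module.Basis ι ℝ E) : (ι → ℤ) →+ E where
  toFun x := ∑ i, (x i : ℝ) • b i
  map_zero' := by simp
  map_add' x y := by simp [add_smul, Finset.sum_add_distrib]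

theorem latticePoint_single {ι E : Type*} [Fintype ι] [DecidableEq ι] [AddCommGroup E] [Module ℝ E]
    (b : Module.Basis ι ℝ E) (i : ι) : latticePoint b (Pi.single i 1) = b i := by
  simp [latticePoint, Pi.single_apply]

theorem latticePoint_eq_restrictScalars {ι E : Type*} [Fintype ι] [AddCommGroup E] [Module ℝ E]
    (b : Module.Basis ι ℝ E) (x : ι → ℤ) :
    latticePoint b x = ((b.restrictScalars ℤ).equivFun.symm x : E) := by
  simp [latticePoint, Module.Basis.equivFun_symm_apply, Int.cast_smul_eq_zsmul]

theorem summable_norm_latticePoint_rpow {ι E : Type*} [Fintype ι] [NormedAddCommGroup E]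
    [NormedSpace ℝ E] (b : Module.Basis ι ℝ E) {r : ℝ} (hr : r < -Fintype.card ι) :
    Summable fun x : ι → ℤ ↦ ‖latticePoint b x‖ ^ r := by
  have : FiniteDimensional ℝ E := b.finiteDimensional_of_finite
  have hcard : Module.finrank ℤ (Submodule.span ℤ (Set.range b)) = Fintype.card ι :=
    Module.finrank_eq_card_basis (b.restrictScalars ℤ)
  have := ZLattice.summable_norm_rpow (Submodule.span ℤ (Set.range b)) r (by rwa [hcard])
  refine ((b.restrictScalars ℤ).equivFun.symm.toEquiv.summable_iff.2 this).congr fun x ↦ ?_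
  simp [latticePoint_eq_restrictScalars]

theorem finite_norm_latticePoint_lt {ι E : Type*} [Fintype ι] [NormedAddCommGroup E]
    [NormedSpace ℝ E] (b : Module.Basis ι ℝ E) (R : ℝ) :
    {x : ι → ℤ | ¬ R ≤ ‖latticePoint b x‖}.Finite := by
  rcases le_or_gt R 0 with hR | hR
  · convert Set.finite_empty
    ext x
    simpa using hR.trans (norm_nonneg _)
  have hs := summable_norm_latticePoint_rpow b (r := -Fintype.card ι - 1) (by linarith)
  have hlt : 0 < R ^ (-Fintype.card ι - 1 : ℝ) := by positivity
  have := hs.tendsto_cofinite_zero.eventually_lt_const hlt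
  rw [Filter.eventually_cofinite] at this
  refine (this.union (Set.finite_singleton 0)).subset fun x hx ↦ ?_
  by_cases h0 : latticePoint b x = 0
  · right
    rw [latticePoint_eq_restrictScalars] at h0
    exact (b.restrictScalars ℤ).equivFun.symm.map_eq_zero_iff.1 (Subtype.ext h0)
  · left
    simp only [not_lt, Set.mem_ofPred_eq, not_le] at hx ⊢
    exact Real.rpow_le_rpow_of_nonpos (norm_pos_iff.2 h0) hx.le
      (by have : (0 : ℝ) ≤ Fintype.card ι := by positivity
          linarith)

/-- The sign character of `ℤ ^ ι` attached to a set of coordinates. -/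
noncomputable def signCharacter {ι : Type*} (T : Finset ι) (x : ι → ℤ) : ℂ := ∏ i ∈ T, (-1 : ℂ) ^ x i

theorem norm_signCharacter {ι : Type*} (T : Finset ι) (x : ι → ℤ) : ‖signCharacter T x‖ = 1 := by
  simp [signCharacter]

theorem signCharacter_add_single {ι : Type*} [DecidableEq ι] {T : Finset ι} {i : ι} (hi : i ∈ T)
    (x : ι → ℤ) : signCharacter T (x + Pi.single i 1) = -signCharacter T x := by
  have : ∀ j, (-1 : ℂ) ^ ((x + Pi.single i 1 : ι → ℤ) j) = (-1 : ℂ) ^ x j * if i = j then -1 else 1 := by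
    intro j
    rw [Pi.add_apply, zpow_add₀ (by norm_num)]
    congr 1
    by_cases h : i = j
    · subst h; simp
    · simp [h, Ne.symm h]
  simp only [signCharacter, this, Finset.prod_mul_distrib]
  simp [hi]

theorem sum_signCharacter_two_mul {ι : Type*} [Fintype ι] (x : ι → ℤ) :
    ∑ T : Finset ι, signCharacter T (2 • x) = 2 ^ Fintype.card ι := by
  have : ∀ T : Finset ι, signCharacter T (2 • x) = 1 := fun T ↦
    Finset.prod_eq_one fun i _ ↦ by simp [zpow_mul]
  simp only [this]
  simp

/-- The sum factors as `∏ i, (1 + (-1) ^ x i)`, and an odd coordinate kills it. -/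
theorem sum_signCharacter_eq_zero {ι : Type*} [Fintype ι] (x : ι → ℤ)
    (hx : x ∉ Set.range fun y : ι → ℤ ↦ 2 • y) : ∑ T : Finset ι, signCharacter T x = 0 := by
  classical
  have h := Finset.prod_one_add (f := fun i ↦ (-1 : ℂ) ^ x i) Finset.univ
  rw [Finset.powerset_univ] at h
  simp only [signCharacter]
  rw [← h]
  by_contra hne
  refine hx ⟨fun i ↦ x i / 2, funext fun i ↦ ?_⟩
  have hi : 1 + (-1 : ℂ) ^ x i ≠ 0 := fun h0 ↦ hne (Finset.prod_eq_zero (Finset.mem_univ i) h0)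
  rcases Int.even_or_odd (x i) with he | ho
  · have := Int.ediv_two_mul_two_of_even he
    simp; lia
  · simp [ho.neg_one_zpow] at hi

/-- Summation by parts: translating by `e` flips the sign of `χ`, so `∑ χ ΔH = -2 ∑ χ H`; iterate.
The right-hand side can make sense where the left-hand side diverges. -/
theorem tsum_mul_eq_tsum_mul_fwdDiff {A : Type*} [AddCommGroup A] {χ : A → ℂ} {e : A}
    (hχ : ∀ x, ‖χ x‖ ≤ 1) (hχe : ∀ x, χ (x + e) = -χ x) {H : A → ℂ} (hH : Summable H) (M : ℕ) :
    ∑' x, χ x * H x = (-1 / 2) ^ M * ∑' x, χ x * (fwdDiff e)^[M] H x := by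
  have hsum : ∀ {H : A → ℂ}, Summable H → Summable fun x ↦ χ x * H x := fun {H} hH ↦
    .of_norm_bounded hH.norm fun x ↦ by
      rw [norm_mul]; exact mul_le_of_le_one_left (norm_nonneg _) (hχ x)
  have hshift : ∀ {H : A → ℂ}, Summable H → Summable fun x ↦ H (x + e) := fun {H} hH ↦
    (Equiv.addRight e).summable_iff.2 hH
  induction M generalizing H with
  | zero => simp
  | succ M ih =>
    have h1 : ∑' x, χ x * H (x + e) = -∑' x, χ x * H x := by
      rw [← tsum_neg, ← (Equiv.addRight e).tsum_eq fun x ↦ -(χ x * H x)]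
      simp [hχe]
    have h2 : ∑' x, χ x * fwdDiff e H x = -2 * ∑' x, χ x * H x := by
      simp only [fwdDiff, mul_sub]
      rw [(hsum (hshift hH)).tsum_sub (hsum hH), h1]
      ring
    rw [Function.iterate_succ, Function.comp_apply, pow_succ, mul_right_comm,
      ← ih (H := fwdDiff e H) ((hshift hH).sub hH), h2]
    ring

end HomogeneousSums

/-! ### Meromorphic continuation of sums over a lattice. -/

section LatticeContinuation

open scoped fwdDiff Topology

variable {ι E : Type} [Fintype ι] [NormedAddCommGroup E] [NormedSpace ℝ E]

/-- The terms `χ(x) Δ^M G(s, x)` are summable locally uniformly for `Re s > 1 - M / d`. -/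
theorem IsHomogeneousFamily.summableLocallyUniformlyOn (b : Module.Basis ι ℝ E) {G : ℂ → E → ℂ}
    (hG : IsHomogeneousFamily G (Fintype.card ι)) [Nonempty ι]
    {χ : (ι → ℤ) → ℂ} (hχ : ∀ x, ‖χ x‖ ≤ 1) (v : E) (M : ℕ) :
    SummableLocallyUniformlyOn
      (fun (x : ι → ℤ) (s : ℂ) ↦ χ x * (fwdDiff v)^[M] (G s) (latticePoint b x))
      {s : ℂ | 1 - M / Fintype.card ι < s.re} := by
  have : FiniteDimensional ℝ E := b.finiteDimensional_of_finite
  have hd : (0 : ℝ) < Fintype.card ι := by exact_mod_cast Fintype.card_pos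
  refine .of_locally_bounded_eventually (isOpen_lt continuous_const Complex.continuous_re) ?_
  intro K hK hKc
  rcases K.eq_empty_or_nonempty with rfl | hne
  · exact ⟨0, summable_zero, by simp⟩
  obtain ⟨s₀, hs₀, hmin⟩ := hKc.exists_isMinOn hne Complex.continuous_re.continuousOn
  obtain ⟨C, R, hC, hR, hb⟩ := hG.exists_norm_fwdDiff_iter_le hKc v M
  refine ⟨fun x ↦ C * ‖latticePoint b x‖ ^ (-(Fintype.card ι * s₀.re) - M),
    (summable_norm_latticePoint_rpow b ?_).mul_left C, ?_⟩
  · have := hK hs₀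
    rw [Set.mem_ofPred_eq, sub_lt_iff_lt_add, ← sub_lt_iff_lt_add', lt_div_iff₀ hd] at this
    linarith
  · rw [Filter.eventually_cofinite]
    refine (finite_norm_latticePoint_lt b R).subset fun x hx hxR ↦ hx fun s hs ↦ ?_
    rw [norm_mul]
    refine (mul_le_of_le_one_left (norm_nonneg _) (hχ x)).trans ((hb s hs _ hxR).trans ?_)
    have h1 : 1 ≤ ‖latticePoint b x‖ := hR.trans hxR
    have h2 : s₀.re ≤ s.re := hmin hs
    refine mul_le_mul_of_nonneg_left (Real.rpow_le_rpow_of_exponent_le h1 ?_) hC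
    linarith [mul_le_mul_of_nonneg_left h2 hd.le]

theorem IsHomogeneousFamily.summable (b : Module.Basis ι ℝ E) {G : ℂ → E → ℂ}
    (hG : IsHomogeneousFamily G (Fintype.card ι)) [Nonempty ι] {s : ℂ} (hs : 1 < s.re) :
    Summable fun x : ι → ℤ ↦ G s (latticePoint b x) := by
  simpa using (hG.summableLocallyUniformlyOn b (χ := 1) (by simp) 0 0).summable
    (x := s) (by simpa using hs)

/-- Taking as many differences as the rank of the lattice moves the abscissa `1 - M / d` to exactly
`0`. -/
theorem IsHomogeneousFamily.differentiableOn_tsum_fwdDiff (b : Module.Basis ι ℝ E) {G : ℂ → E → ℂ}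
    (hG : IsHomogeneousFamily G (Fintype.card ι)) [Nonempty ι]
    {χ : (ι → ℤ) → ℂ} (hχ : ∀ x, ‖χ x‖ ≤ 1) (v : E) :
    DifferentiableOn ℂ (fun s ↦ ∑' x : ι → ℤ,
      χ x * (fwdDiff v)^[Fintype.card ι] (G s) (latticePoint b x)) {s : ℂ | 0 < s.re} := by
  have hset : {s : ℂ | 1 - (Fintype.card ι : ℝ) / Fintype.card ι < s.re} = {s : ℂ | 0 < s.re} := by
    simp
  have h := hG.summableLocallyUniformlyOn b hχ v (Fintype.card ι)
  rw [hset] at h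
  refine h.differentiableOn (isOpen_lt continuous_const Complex.continuous_re) fun x s _ ↦ ?_
  refine DifferentiableAt.const_mul ?_ _
  simp only [fwdDiff_iter_eq_sum_shift, zsmul_eq_mul]
  exact DifferentiableAt.fun_sum fun k _ ↦ ((hG.differentiable _) s).const_mul _

theorem fwdDiff_iter_comp_latticePoint [DecidableEq ι] (b : Module.Basis ι ℝ E) (g : E → ℂ) (i : ι)
    (M : ℕ) (x : ι → ℤ) : (fwdDiff (Pi.single i 1 : ι → ℤ))^[M] (fun x ↦ g (latticePoint b x)) x =
      (fwdDiff (b i))^[M] g (latticePoint b x) := by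
  simp only [fwdDiff_iter_eq_sum_shift, map_add, map_nsmul, latticePoint_single]

/-- Averaging over all sign characters detects the sublattice `2Λ`, on which homogeneity pulls out a
power of `2`. -/
theorem IsHomogeneousFamily.sum_tsum_signCharacter (b : Module.Basis ι ℝ E) {G : ℂ → E → ℂ}
    (hG : IsHomogeneousFamily G (Fintype.card ι)) [Nonempty ι] {s : ℂ} (hs : 1 < s.re) :
    ∑ T : Finset ι, ∑' x : ι → ℤ, signCharacter T x * G s (latticePoint b x) =
      2 ^ Fintype.card ι * (2 : ℂ) ^ (-(Fintype.card ι * s)) *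
        ∑' x : ι → ℤ, G s (latticePoint b x) := by
  have hsum := hG.summable b hs
  rw [← Summable.tsum_finsetSum fun T _ ↦ .of_norm_bounded hsum.norm fun x ↦ by
    rw [norm_mul, norm_signCharacter, one_mul]]
  simp_rw [← Finset.sum_mul]
  have hinj : Function.Injective fun y : ι → ℤ ↦ 2 • y := fun x y h ↦ by
    funext i
    have := congrFun h i
    simpa using this
  rw [← hinj.tsum_eq, ← tsum_mul_left]
  · refine tsum_congr fun x ↦ ?_
    have h2 : latticePoint b (2 • x) = (2 : ℝ) • latticePoint b x := by
      rw [map_nsmul, ← Nat.cast_smul_eq_nsmul ℝ, Nat.cast_ofNat]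
    rw [sum_signCharacter_two_mul, h2, hG.smul _ _ _ two_pos]
    push_cast
    ring
  · intro x hx
    by_contra hxr
    exact hx (by simp only [sum_signCharacter_eq_zero x hxr, zero_mul])

/-- The sum of a homogeneous family over the points of a lattice continues meromorphically to
`Re s > 0`. -/
theorem IsHomogeneousFamily.exists_meromorphicOn_tsum (b : Module.Basis ι ℝ E) {G : ℂ → E → ℂ}
    (hG : IsHomogeneousFamily G (Fintype.card ι)) [Nonempty ι] :
    ∃ F : ℂ → ℂ, MeromorphicOn F {s : ℂ | 0 < s.re} ∧
      ∀ s : ℂ, 1 < s.re → F s = ∑' x : ι → ℤ, G s (latticePoint b x) := by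
  classical
  set n := Fintype.card ι with hn
  have hn0 : 0 < n := Fintype.card_pos
  -- The analogue of `1 - 2^(1-s)`: the untwisted sum is the term `T = ∅`, and solving the character
  -- identity for it leaves this factor. It vanishes at `s = 1`, so dividing by it allows a pole
  -- there.
  let q : ℂ → ℂ := fun s ↦ 1 - 2 ^ n * (2 : ℂ) ^ (-(n * s))
  -- A nonempty `T` provides a coordinate whose unit vector reverses the sign of its character, as
  -- summation by parts requires.
  let D : Finset ι → ℂ → ℂ := fun T s ↦ if h : T.Nonempty then (-1 / 2) ^ n *
    ∑' x : ι → ℤ, signCharacter T x * (fwdDiff (b h.choose))^[n] (G s) (latticePoint b x) else 0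
  have hDdiff : ∀ T, DifferentiableOn ℂ (D T) {s : ℂ | 0 < s.re} := by
    intro T
    by_cases h : T.Nonempty
    · simp only [D, dif_pos h]
      exact (hG.differentiableOn_tsum_fwdDiff b (fun x ↦ (norm_signCharacter T x).le) _).const_mul _
    · simp only [D, dif_neg h]
      exact differentiableOn_const _
  have hD : ∀ T : Finset ι, T.Nonempty → ∀ s : ℂ, 1 < s.re →
      D T s = ∑' x : ι → ℤ, signCharacter T x * G s (latticePoint b x) := by
    intro T h s hs
    simp only [D, dif_pos h]
    rw [tsum_mul_eq_tsum_mul_fwdDiff (e := Pi.single h.choose 1)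
      (fun x ↦ (norm_signCharacter T x).le)
      (fun x ↦ signCharacter_add_single h.choose_spec x) (hG.summable b hs) n]
    simp only [fwdDiff_iter_comp_latticePoint]
  have hq : Differentiable ℂ q := by
    have : (2 : ℂ) ≠ 0 := two_ne_zero
    fun_prop (disch := simp)
  have hopen : IsOpen {s : ℂ | 0 < s.re} := isOpen_lt continuous_const Complex.continuous_re
  refine ⟨fun s ↦ (q s)⁻¹ * -∑ T ∈ Finset.univ.erase ∅, D T s, ?_, ?_⟩
  · intro s hs
    refine (hq.analyticAt s).meromorphicAt.inv.mul (AnalyticAt.meromorphicAt ?_)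
    exact ((DifferentiableOn.fun_sum fun T _ ↦ hDdiff T).neg).analyticAt (hopen.mem_nhds hs)
  · intro s hs
    beta_reduce
    have h := hG.sum_tsum_signCharacter b hs
    rw [← Finset.add_sum_erase _ _ (Finset.mem_univ ∅)] at h
    have h0 : ∀ x : ι → ℤ, signCharacter ∅ x = 1 := fun x ↦ by simp [signCharacter]
    simp only [h0, one_mul] at h
    rw [Finset.sum_congr rfl fun T hT ↦ hD T
      (Finset.nonempty_iff_ne_empty.2 (Finset.ne_of_mem_erase hT)) s hs]
    have hq0 : q s ≠ 0 := by
      intro h0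
      have h1 : (2 : ℂ) ^ n * (2 : ℂ) ^ (-(n * s)) = 1 := (sub_eq_zero.1 h0).symm
      rw [← Complex.cpow_natCast, ← Complex.cpow_add _ _ two_ne_zero] at h1
      have h2 := congrArg norm h1
      rw [norm_one, show (2 : ℂ) = ((2 : ℝ) : ℂ) by norm_num,
        Complex.norm_cpow_eq_rpow_re_of_pos two_pos] at h2
      have h3 : ((n : ℂ) + -(n * s)).re = n * (1 - s.re) := by simp; ring
      rw [h3] at h2
      have : (n : ℝ) * (1 - s.re) < 0 :=
        mul_neg_of_pos_of_neg (by exact_mod_cast hn0) (by linarith)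
      exact (Real.rpow_lt_one_of_one_lt_of_neg one_lt_two this).ne h2
    rw [inv_mul_eq_iff_eq_mul₀ hq0]
    simp only [q]
    linear_combination -h

end LatticeContinuation

/-! ### A smooth substitute for the fundamental cone of the unit group. -/

section ConeWeight

open NumberField NumberField.Units NumberField.mixedEmbedding NumberField.InfinitePlace
  NumberField.Units.dirichletUnitTheorem

/-- A smooth bump on `ℝ` whose integer translates sum to `1`. -/
noncomputable def unitBump (t : ℝ) : ℝ := Real.smoothTransition (t + 1) - Real.smoothTransition t

theorem contDiff_unitBump : ContDiff ℝ ∞ unitBump := by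
  have h : ContDiff ℝ ∞ Real.smoothTransition := Real.smoothTransition.contDiff (n := (⊤ : ℕ∞))
  exact (h.comp (contDiff_id.add contDiff_const)).sub h

theorem unitBump_eq_zero_of_one_le {t : ℝ} (ht : 1 ≤ t) : unitBump t = 0 := by
  rw [unitBump, Real.smoothTransition.one_of_one_le ht,
    Real.smoothTransition.one_of_one_le (by linarith), sub_self]

theorem unitBump_eq_zero_of_le_neg_one {t : ℝ} (ht : t ≤ -1) : unitBump t = 0 := by
  rw [unitBump, Real.smoothTransition.zero_of_nonpos (by linarith),
    Real.smoothTransition.zero_of_nonpos (by linarith), sub_self]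

theorem abs_le_one_of_unitBump_ne_zero {t : ℝ} (ht : unitBump t ≠ 0) : |t| ≤ 1 := by
  rw [abs_le]
  by_contra h
  rw [not_and_or, not_le, not_le] at h
  rcases h with h | h
  · exact ht (unitBump_eq_zero_of_le_neg_one h.le)
  · exact ht (unitBump_eq_zero_of_one_le h.le)

theorem unitBump_add_intCast_eq_zero (c : ℝ) {m : ℤ}
    (hm : m ∉ ({-⌊c⌋ - 1, -⌊c⌋} : Finset ℤ)) : unitBump (c + m) = 0 := by
  have h1 := Int.floor_le c
  have h2 := Int.lt_floor_add_one c
  simp only [Finset.mem_insert, Finset.mem_singleton, not_or] at hm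
  rcases lt_or_ge m (-⌊c⌋) with h | h
  · have : m ≤ -⌊c⌋ - 2 := by lia
    have : (m : ℝ) ≤ -⌊c⌋ - 2 := by exact_mod_cast this
    exact unitBump_eq_zero_of_le_neg_one (by linarith)
  · have : -⌊c⌋ + 1 ≤ m := by lia
    have : (-⌊c⌋ + 1 : ℝ) ≤ m := by exact_mod_cast this
    exact unitBump_eq_zero_of_one_le (by linarith)

/-- The two translates telescope to the difference of the smooth transition at `c - ⌊c⌋ + 1 ≥ 1` and
at `c - ⌊c⌋ - 1 ≤ 0`; all other translates vanish at `c`. -/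
theorem sum_unitBump_add_intCast (c : ℝ) :
    ∑ m ∈ ({-⌊c⌋ - 1, -⌊c⌋} : Finset ℤ), unitBump (c + m) = 1 := by
  have h1 := Int.floor_le c
  have h2 := Int.lt_floor_add_one c
  rw [Finset.sum_pair (by lia)]
  simp only [unitBump]
  push_cast
  rw [Real.smoothTransition.zero_of_nonpos (x := c + (-⌊c⌋ - 1)) (by linarith),
    Real.smoothTransition.one_of_one_le (x := c + -⌊c⌋ + 1) (by linarith),
    show c + (-(⌊c⌋ : ℝ) - 1) + 1 = c + -⌊c⌋ by ring]
  ring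

open scoped Classical

variable (K : Type) [Field K] [NumberField K]

/-- The coordinates of the logarithm of a point of the mixed space with respect to a basis of the
unit lattice. -/
noncomputable def logCoord (x : mixedSpace K) (i : Fin (rank K)) : ℝ :=
  ((basisUnitLattice K).ofZLatticeBasis ℝ (unitLattice K)).repr (logMap x) i

/-- A smooth cone-supported weight on the mixed space, times `N(x) ^ (-s)`. -/
noncomputable def coneFamily (s : ℂ) (x : mixedSpace K) : ℂ :=
  if mixedEmbedding.norm x = 0 then 0 else
    ((∏ i, unitBump (logCoord K x i) : ℝ) : ℂ) * (mixedEmbedding.norm x : ℂ) ^ (-s)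

variable {K}

theorem contDiffAt_normAtPlace {x : mixedSpace K} {w : InfinitePlace K} (h : normAtPlace w x ≠ 0) :
    ContDiffAt ℝ ∞ (normAtPlace w : mixedSpace K → ℝ) x := by
  rcases isReal_or_isComplex w with hw | hw
  · have e : (normAtPlace w : mixedSpace K → ℝ) = fun x ↦ ‖x.1 ⟨w, hw⟩‖ :=
      funext fun x ↦ normAtPlace_apply_of_isReal hw x
    rw [normAtPlace_apply_of_isReal hw, norm_ne_zero_iff] at h
    rw [e]
    exact ContDiffAt.norm ℝ (by fun_prop) h
  · have e : (normAtPlace w : mixedSpace K → ℝ) = fun x ↦ ‖x.2 ⟨w, hw⟩‖ :=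
      funext fun x ↦ normAtPlace_apply_of_isComplex hw x
    rw [normAtPlace_apply_of_isComplex hw, norm_ne_zero_iff] at h
    rw [e]
    exact ContDiffAt.norm ℝ (by fun_prop) h

theorem contDiffAt_mixedEmbedding_norm {x : mixedSpace K} (h : mixedEmbedding.norm x ≠ 0) :
    ContDiffAt ℝ ∞ (mixedEmbedding.norm : mixedSpace K → ℝ) x := by
  have e : (mixedEmbedding.norm : mixedSpace K → ℝ) = fun x ↦ ∏ w, normAtPlace w x ^ mult w :=
    funext fun x ↦ mixedEmbedding.norm_apply x
  rw [e]
  exact contDiffAt_prod fun w _ ↦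
    (contDiffAt_normAtPlace (mixedEmbedding.norm_ne_zero_iff.1 h w)).pow _

theorem contDiffAt_logCoord {x : mixedSpace K} (h : mixedEmbedding.norm x ≠ 0)
    (i : Fin (rank K)) : ContDiffAt ℝ ∞ (fun x ↦ logCoord K x i) x := by
  have h1 : ContDiffAt ℝ ∞ (logMap : mixedSpace K → logSpace K) x := by
    refine contDiffAt_pi.2 fun w ↦ ?_
    simp only [logMap_apply]
    exact contDiffAt_const.mul (((contDiffAt_normAtPlace
      (mixedEmbedding.norm_ne_zero_iff.1 h w)).log (mixedEmbedding.norm_ne_zero_iff.1 h w)).sub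
      (((contDiffAt_mixedEmbedding_norm h).log h).mul contDiffAt_const))
  exact (LinearMap.toContinuousLinearMap
    (((basisUnitLattice K).ofZLatticeBasis ℝ (unitLattice K)).coord i)).contDiff.contDiffAt.comp x h1

theorem exists_norm_logMap_le : ∃ B : ℝ, 0 ≤ B ∧ ∀ x : mixedSpace K, (∀ i, |logCoord K x i| ≤ 1) →
    ‖logMap x‖ ≤ B := by
  set b := (basisUnitLattice K).ofZLatticeBasis ℝ (unitLattice K) with hb
  refine ⟨∑ i, ‖b i‖, by positivity, fun x hx ↦ ?_⟩
  rw [← b.sum_repr (logMap x)]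
  refine norm_sum_le_of_le _ fun i _ ↦ ?_
  rw [_root_.norm_smul]
  exact mul_le_of_le_one_left (norm_nonneg _) (hx i)

/-- Bounded logarithmic coordinates keep every `log |x|_w` close to the common mean `l`. For the
place `w₀` omitted by `logMap` this follows because the weighted deviations from `l` sum to `0`.
Hence all places are comparable with the largest one, which is `‖x‖`, and the support of the cone
weight meets the locus of norm zero only at the origin. -/
theorem exists_mul_norm_le_normAtPlace : ∃ δ : ℝ, 0 < δ ∧ ∀ x : mixedSpace K,
    mixedEmbedding.norm x ≠ 0 → (∀ i, |logCoord K x i| ≤ 1) → ∀ w, δ * ‖x‖ ≤ normAtPlace w x := by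
  obtain ⟨B, hB0, hB⟩ := exists_norm_logMap_le (K := K)
  set n : ℕ := Fintype.card (InfinitePlace K) with hn
  have hn1 : (1 : ℝ) ≤ n := by exact_mod_cast Fintype.card_pos
  -- Both `w` and the place attaining `‖x‖` deviate from `l` by at most `n B`.
  refine ⟨Real.exp (-(2 * (n * B))), Real.exp_pos _, fun x hx hc w ↦ ?_⟩
  have hlog := hB x hc
  have hne := mixedEmbedding.norm_ne_zero_iff.1 hx
  set l : ℝ := Real.log (mixedEmbedding.norm x) * (Module.finrank ℚ K : ℝ)⁻¹ with hl
  have hterm : ∀ w : InfinitePlace K, w ≠ w₀ →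
      |(mult w : ℝ) * (Real.log (normAtPlace w x) - l)| ≤ B := by
    intro w hw
    have := (norm_le_pi_norm (logMap x) ⟨w, hw⟩).trans hlog
    rwa [logMap_apply, Real.norm_eq_abs] at this
  have hsum : ∑ w : InfinitePlace K, (mult w : ℝ) * (Real.log (normAtPlace w x) - l) = 0 := by
    have h1 : Real.log (mixedEmbedding.norm x) =
        ∑ w : InfinitePlace K, (mult w : ℝ) * Real.log (normAtPlace w x) := by
      rw [mixedEmbedding.norm_apply, Real.log_prod fun w _ ↦ pow_ne_zero _ (hne w)]
      simp
    have h2 : ∑ w : InfinitePlace K, (mult w : ℝ) = Module.finrank ℚ K := by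
      exact_mod_cast sum_mult_eq (K := K)
    have h3 : (Module.finrank ℚ K : ℝ) ≠ 0 := by exact_mod_cast Module.finrank_pos.ne'
    simp only [mul_sub, Finset.sum_sub_distrib, ← Finset.sum_mul]
    rw [← h1, h2, hl]
    field_simp
    ring
  have hall : ∀ w : InfinitePlace K, |Real.log (normAtPlace w x) - l| ≤ n * B := by
    intro w
    have hmult : (1 : ℝ) ≤ mult w := by exact_mod_cast one_le_mult
    have h1 : |Real.log (normAtPlace w x) - l| ≤
        |(mult w : ℝ) * (Real.log (normAtPlace w x) - l)| := by
      rw [abs_mul, abs_of_pos (by linarith : (0 : ℝ) < mult w)]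
      exact le_mul_of_one_le_left (abs_nonneg _) hmult
    refine h1.trans ?_
    by_cases hw : w = w₀
    · subst hw
      rw [← Finset.add_sum_erase _ _ (Finset.mem_univ w₀), add_eq_zero_iff_eq_neg] at hsum
      rw [hsum, abs_neg]
      refine (Finset.abs_sum_le_sum_abs _ _).trans ((Finset.sum_le_card_nsmul _ _ B
        fun w hw ↦ hterm w (Finset.ne_of_mem_erase hw)).trans ?_)
      rw [nsmul_eq_mul]
      gcongr
      exact Finset.card_le_univ _
    · exact (hterm w hw).trans (le_mul_of_one_le_left hB0 hn1)
  obtain ⟨w', -, hw'⟩ := Finset.exists_mem_eq_sup' Finset.univ_nonempty fun w ↦ normAtPlace w x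
  rw [norm_eq_sup'_normAtPlace, hw']
  have hp : ∀ w, 0 < normAtPlace w x := fun w ↦ (normAtPlace_nonneg w x).lt_of_ne' (hne w)
  rw [← Real.exp_log (hp w), ← Real.exp_log (hp w'), ← Real.exp_add, Real.exp_le_exp]
  have h1 := abs_le.1 (hall w)
  have h2 := abs_le.1 (hall w')
  linarith [h1.1, h2.2]

/-- Where the norm is nonzero the formula is visibly smooth. At a nonzero point of norm zero some
place vanishes, so by `exists_mul_norm_le_normAtPlace` the weight is zero in a whole neighbourhood.
-/
theorem contDiffOn_coneFamily : ContDiffOn ℝ ∞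
    (fun p : ℂ × mixedSpace K ↦ coneFamily K p.1 p.2) (Set.univ ×ˢ {0}ᶜ) := by
  rintro ⟨s, x⟩ ⟨-, hx⟩
  refine ContDiffAt.contDiffWithinAt ?_
  have hcont : Continuous fun p : ℂ × mixedSpace K ↦ mixedEmbedding.norm p.2 :=
    (mixedEmbedding.continuous_norm K).comp continuous_snd
  by_cases h : mixedEmbedding.norm x = 0
  · obtain ⟨δ, hδ, hb⟩ := exists_mul_norm_le_normAtPlace (K := K)
    obtain ⟨w, hw⟩ := mixedEmbedding.norm_eq_zero_iff.1 h
    have hev : ∀ᶠ p : ℂ × mixedSpace K in nhds (s, x), normAtPlace w p.2 < δ * ‖p.2‖ := by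
      refine (isOpen_lt (by fun_prop) (by fun_prop)).mem_nhds ?_
      simp only [Set.mem_ofPred_eq, hw]
      exact mul_pos hδ (norm_pos_iff.2 hx)
    refine (contDiffAt_const (c := (0 : ℂ))).congr_of_eventuallyEq ?_
    filter_upwards [hev] with p hp
    rw [coneFamily]
    split_ifs with hN
    · rfl
    · by_contra hne
      refine hp.not_ge (hb p.2 hN (fun i ↦ abs_le_one_of_unitBump_ne_zero fun h0 ↦ hne ?_) w)
      rw [Finset.prod_eq_zero (Finset.mem_univ i) h0]
      simp
  · have hev : ∀ᶠ p : ℂ × mixedSpace K in nhds (s, x), mixedEmbedding.norm p.2 ≠ 0 :=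
      (isOpen_ne_fun hcont continuous_const).mem_nhds h
    have hpos : 0 < mixedEmbedding.norm x := (mixedEmbedding.norm_nonneg x).lt_of_ne' h
    have hN : ContDiffAt ℝ ∞ (fun p : ℂ × mixedSpace K ↦ mixedEmbedding.norm p.2) (s, x) :=
      ContDiffAt.comp (s, x) (contDiffAt_mixedEmbedding_norm h) contDiffAt_snd
    have hprod : ContDiffAt ℝ ∞
        (fun p : ℂ × mixedSpace K ↦ ∏ i, unitBump (logCoord K p.2 i)) (s, x) :=
      contDiffAt_prod fun i _ ↦ contDiff_unitBump.contDiffAt.comp (s, x)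
        (ContDiffAt.comp (s, x) (contDiffAt_logCoord h i) contDiffAt_snd)
    have hre : ∀ {f : ℂ × mixedSpace K → ℝ}, ContDiffAt ℝ ∞ f (s, x) →
        ContDiffAt ℝ ∞ (fun p ↦ (f p : ℂ)) (s, x) := fun hf ↦
      Complex.ofRealCLM.contDiff.contDiffAt.comp (s, x) hf
    have hmain : ContDiffAt ℝ ∞ (fun p : ℂ × mixedSpace K ↦
        ((∏ i, unitBump (logCoord K p.2 i) : ℝ) : ℂ) *
          Complex.exp ((Real.log (mixedEmbedding.norm p.2) : ℝ) * -p.1)) (s, x) :=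
      (hre hprod).mul (((hre (hN.log h)).mul contDiffAt_fst.neg).cexp)
    refine hmain.congr_of_eventuallyEq ?_
    filter_upwards [hev] with p hp
    rw [coneFamily, if_neg hp, Complex.cpow_def_of_ne_zero (by exact_mod_cast hp),
      Complex.ofReal_log (mixedEmbedding.norm_nonneg _)]

theorem logCoord_smul {x : mixedSpace K} (h : mixedEmbedding.norm x ≠ 0) {t : ℝ} (ht : t ≠ 0) :
    logCoord K (t • x) = logCoord K x := by
  ext i
  rw [logCoord, logCoord, logMap_real_smul h ht]

theorem isHomogeneousFamily_coneFamily :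
    IsHomogeneousFamily (coneFamily K) (Module.finrank ℚ K) where
  contDiffOn := contDiffOn_coneFamily
  smul s x t ht := by
    rw [coneFamily, coneFamily, mixedEmbedding.norm_smul, abs_of_pos ht]
    by_cases h : mixedEmbedding.norm x = 0
    · simp [h]
    · rw [if_neg h, if_neg (mul_ne_zero (pow_ne_zero _ ht.ne') h), logCoord_smul h ht.ne',
        Complex.ofReal_mul, Complex.mul_cpow_ofReal_nonneg (by positivity)
        (mixedEmbedding.norm_nonneg _), Complex.ofReal_pow, ← mul_neg, Complex.cpow_nat_mul',
        mul_left_comm]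
      · rw [Complex.arg_ofReal_of_nonneg ht.le, mul_zero, neg_lt_zero]; exact Real.pi_pos
      · rw [Complex.arg_ofReal_of_nonneg ht.le, mul_zero]; exact Real.pi_pos.le
  differentiable x := by
    by_cases h : mixedEmbedding.norm x = 0
    · simp [coneFamily, h]
    · simp only [coneFamily, h, if_false]
      have : (mixedEmbedding.norm x : ℂ) ≠ 0 := by exact_mod_cast h
      fun_prop (disch := simp [h])
  map_zero s := by simp [coneFamily]

/-- The decomposition of units into roots of unity and powers of fundamental units. -/
noncomputable def torsionProdEquivUnits : torsion K × (Fin (rank K) → ℤ) ≃ (𝓞 K)ˣ :=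
  Equiv.ofBijective (fun p ↦ p.1 * ∏ i, fundSystem K i ^ p.2 i) (by
    rw [Function.bijective_iff_existsUnique]
    intro u
    simpa only [eq_comm] using exist_unique_eq_mul_prod K u)

theorem logCoord_torsionProdEquivUnits_smul {x : mixedSpace K} (h : mixedEmbedding.norm x ≠ 0)
    (p : torsion K × (Fin (rank K) → ℤ)) (i : Fin (rank K)) :
    logCoord K (torsionProdEquivUnits p • x) i = logCoord K x i + p.2 i := by
  have h1 : logEmbedding K (Additive.ofMul (torsionProdEquivUnits p)) =
      ∑ i, (p.2 i : ℝ) • ((basisUnitLattice K).ofZLatticeBasis ℝ (unitLattice K)) i := by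
    have h0 : logEmbedding K (Additive.ofMul (p.1 : (𝓞 K)ˣ)) = 0 :=
      logEmbedding_eq_zero_iff.2 p.1.2
    rw [torsionProdEquivUnits, Equiv.ofBijective_apply, ofMul_mul, map_add, h0, zero_add, ofMul_prod,
      map_sum]
    refine Finset.sum_congr rfl fun i _ ↦ ?_
    rw [ofMul_zpow, map_zsmul, logEmbedding_fundSystem, Module.Basis.ofZLatticeBasis_apply,
      Int.cast_smul_eq_zsmul]
  rw [logCoord, logMap_unit_smul _ h, h1, map_add, Finsupp.add_apply, Module.Basis.repr_sum_self,
    add_comm, logCoord]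

/-- Fundamental units translate the logarithmic coordinates by integers, so the bumps sum to `1` in
each coordinate; roots of unity do not move them and contribute their number. This is the sense in
which the weight replaces a fundamental domain. -/
theorem hasSum_coneFamily_unit_smul (s : ℂ) {x : mixedSpace K} (h : mixedEmbedding.norm x ≠ 0) :
    HasSum (fun u : (𝓞 K)ˣ ↦ coneFamily K s (u • x))
      (torsionOrder K * (mixedEmbedding.norm x : ℂ) ^ (-s)) := by
  have := Fintype.ofFinite (torsion K)
  rw [← torsionProdEquivUnits.hasSum_iff]
  have hfun : ∀ p : torsion K × (Fin (rank K) → ℤ),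
      coneFamily K s (torsionProdEquivUnits p • x) =
      ((∏ i, unitBump (logCoord K x i + p.2 i) : ℝ) : ℂ) * (mixedEmbedding.norm x : ℂ) ^ (-s) := by
    intro p
    rw [coneFamily, norm_unit_smul, if_neg h]
    simp only [logCoord_torsionProdEquivUnits_smul h]
  have hS := hasSum_sum_of_ne_finset_zero (L := .unconditional _)
    (f := fun p : torsion K × (Fin (rank K) → ℤ) ↦
      coneFamily K s (torsionProdEquivUnits p • x))
    (s := Finset.univ ×ˢ Fintype.piFinset fun i ↦
      ({-⌊logCoord K x i⌋ - 1, -⌊logCoord K x i⌋} : Finset ℤ)) (by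
      rintro ⟨ζ, e⟩ hp
      simp only [Finset.mem_product, Finset.mem_univ, true_and, Fintype.mem_piFinset,
        not_forall] at hp
      obtain ⟨i, hi⟩ := hp
      rw [hfun, Finset.prod_eq_zero (Finset.mem_univ i) (unitBump_add_intCast_eq_zero _ hi)]
      simp)
  convert hS using 1
  · rfl
  simp only [hfun]
  rw [Finset.sum_product]
  dsimp only
  rw [Finset.sum_const, ← Finset.sum_mul, ← Complex.ofReal_sum,
    ← Finset.prod_univ_sum (fun i ↦ ({-⌊logCoord K x i⌋ - 1, -⌊logCoord K x i⌋} : Finset ℤ))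
      (fun i (m : ℤ) ↦ unitBump (logCoord K x i + (m : ℝ)))]
  simp only [sum_unitBump_add_intCast]
  simp [torsionOrder]

end ConeWeight

/-! ### From lattice sums to the Dedekind zeta function. -/

section DedekindContinuation

theorem hasSum_of_forall_eq {α β : Type*} [AddCommMonoid β] [TopologicalSpace β] {f g : α → β}
    {a : β} (hf : HasSum f a) (h : ∀ i, g i = f i) : HasSum g a := by
  rwa [funext h]

open NumberField NumberField.Units NumberField.mixedEmbedding NumberField.InfinitePlace
  NumberField.Units.dirichletUnitTheorem
open scoped Classical nonZeroDivisors

set_option linter.unusedSectionVars false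

variable (K : Type) [Field K] [NumberField K]

/-- A nonzero ideal is isomorphic to the lattice it spans in the mixed space. -/
noncomputable def idealEquivSpan (J : (Ideal (𝓞 K))⁰) : (J : Ideal (𝓞 K)) ≃
    Submodule.span ℤ (Set.range (fractionalIdealLatticeBasis K (FractionalIdeal.mk0 K J))) :=
  Equiv.ofBijective (fun a ↦ ⟨mixedEmbedding K (a : 𝓞 K),
    (mem_span_fractionalIdealLatticeBasis K _).2 ⟨(a : 𝓞 K), by
      rw [FractionalIdeal.coe_mk0]
      exact (FractionalIdeal.mem_coeIdeal (𝓞 K)⁰).2 ⟨a, a.2, rfl⟩, rfl⟩⟩) (by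
    constructor
    · intro a a' h
      have := mixedEmbedding_injective K (congrArg Subtype.val h)
      exact Subtype.ext (RingOfIntegers.coe_injective this)
    · rintro ⟨y, hy⟩
      obtain ⟨x, hx, rfl⟩ := (mem_span_fractionalIdealLatticeBasis K _).1 hy
      rw [FractionalIdeal.coe_mk0] at hx
      obtain ⟨a, ha, rfl⟩ := (FractionalIdeal.mem_coeIdeal (𝓞 K)⁰).1 hx
      exact ⟨⟨a, ha⟩, rfl⟩)

/-- Integral coordinates for the elements of a nonzero ideal. -/
noncomputable def intCoordEquivIdeal (J : (Ideal (𝓞 K))⁰) :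
    (Module.Free.ChooseBasisIndex ℤ (FractionalIdeal.mk0 K J : FractionalIdeal (𝓞 K)⁰ K) → ℤ) ≃
      (J : Ideal (𝓞 K)) :=
  ((fractionalIdealLatticeBasis K (FractionalIdeal.mk0 K J)).restrictScalars
    ℤ).equivFun.symm.toEquiv.trans (idealEquivSpan K J).symm

theorem mixedEmbedding_intCoordEquivIdeal (J : (Ideal (𝓞 K))⁰)
    (x : Module.Free.ChooseBasisIndex ℤ (FractionalIdeal.mk0 K J : FractionalIdeal (𝓞 K)⁰ K) → ℤ) :
    mixedEmbedding K (intCoordEquivIdeal K J x : 𝓞 K) =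
      latticePoint (fractionalIdealLatticeBasis K (FractionalIdeal.mk0 K J)) x := by
  rw [latticePoint_eq_restrictScalars]
  change ((idealEquivSpan K J ((idealEquivSpan K J).symm _)) : mixedSpace K) = _
  rw [Equiv.apply_symm_apply]
  rfl

theorem card_index_fractionalIdealLatticeBasis (J : (Ideal (𝓞 K))⁰) :
    Fintype.card
      (Module.Free.ChooseBasisIndex ℤ (FractionalIdeal.mk0 K J : FractionalIdeal (𝓞 K)⁰ K)) =
      Module.finrank ℚ K := by
  rw [← Module.finrank_eq_card_basis (fractionalIdealLatticeBasis K (FractionalIdeal.mk0 K J)),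
    mixedEmbedding.finrank]

/-- The principal ideals divisible by `J`. -/
abbrev PrincipalMultiple (J : (Ideal (𝓞 K))⁰) : Type :=
  {I : (Ideal (𝓞 K))⁰ // J ∣ I ∧ (I : Ideal (𝓞 K)).IsPrincipal}

variable {K}

theorem PrincipalMultiple.exists_generator {J : (Ideal (𝓞 K))⁰} (I : PrincipalMultiple K J) :
    ∃ a : 𝓞 K, a ≠ 0 ∧ (I.1 : Ideal (𝓞 K)) = Ideal.span {a} := by
  obtain ⟨a, ha⟩ := I.2.2
  refine ⟨a, ?_, ha⟩
  rintro rfl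
  exact nonZeroDivisors.coe_ne_zero I.1 (by rw [ha]; simp)

/-- A generator of a principal ideal. -/
noncomputable def PrincipalMultiple.gen {J : (Ideal (𝓞 K))⁰} (I : PrincipalMultiple K J) : 𝓞 K :=
  I.exists_generator.choose

theorem PrincipalMultiple.gen_ne_zero {J : (Ideal (𝓞 K))⁰} (I : PrincipalMultiple K J) :
    I.gen ≠ 0 := I.exists_generator.choose_spec.1

theorem PrincipalMultiple.span_gen {J : (Ideal (𝓞 K))⁰} (I : PrincipalMultiple K J) :
    (I.1 : Ideal (𝓞 K)) = Ideal.span {I.gen} := I.exists_generator.choose_spec.2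

theorem PrincipalMultiple.gen_mem {J : (Ideal (𝓞 K))⁰} (I : PrincipalMultiple K J) :
    I.gen ∈ (J : Ideal (𝓞 K)) := by
  have h : (J : Ideal (𝓞 K)) ∣ I.1 := nonZeroDivisors_dvd_iff_dvd_coe.1 I.2.1
  rw [I.span_gen, Ideal.dvd_span_singleton] at h
  exact h

/-- The nonzero elements of an ideal are the unit multiples of the generators of the principal
ideals it contains. -/
noncomputable def principalMultipleProdUnitsEquiv (J : (Ideal (𝓞 K))⁰) :
    PrincipalMultiple K J × (𝓞 K)ˣ ≃ {a : (J : Ideal (𝓞 K)) // (a : 𝓞 K) ≠ 0} :=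
  Equiv.ofBijective (fun p ↦ ⟨⟨p.2 * p.1.gen, Ideal.mul_mem_left _ _ p.1.gen_mem⟩,
    mul_ne_zero p.2.ne_zero p.1.gen_ne_zero⟩) (by
    constructor
    · rintro ⟨I, u⟩ ⟨I', u'⟩ h
      have h1 : (u : 𝓞 K) * I.gen = u' * I'.gen := congrArg (fun x ↦ ((x.1 : _) : 𝓞 K)) h
      have h2 : I = I' := by
        apply Subtype.ext
        apply Subtype.ext
        rw [I.span_gen, I'.span_gen, Ideal.span_singleton_eq_span_singleton]
        exact (associated_unit_mul_left _ _ u.isUnit).symm.trans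
          (h1 ▸ associated_unit_mul_left _ _ u'.isUnit)
      subst h2
      rw [Prod.mk.injEq]
      exact ⟨rfl, Units.ext (mul_right_cancel₀ I.gen_ne_zero h1)⟩
    · rintro ⟨⟨a, ha⟩, ha0⟩
      have hne : Ideal.span {a} ≠ ⊥ := by simpa using ha0
      let I : PrincipalMultiple K J := ⟨⟨Ideal.span {a}, mem_nonZeroDivisors_of_ne_zero hne⟩,
        nonZeroDivisors_dvd_iff_dvd_coe.2 (Ideal.dvd_span_singleton.2 ha), ⟨a, rfl⟩⟩
      have h : Associated I.gen a := by
        rw [← Ideal.span_singleton_eq_span_singleton, ← I.span_gen]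
      obtain ⟨u, hu⟩ := h
      exact ⟨(I, u), Subtype.ext (Subtype.ext (show (u : 𝓞 K) * I.gen = a by rw [mul_comm, hu]))⟩)

theorem norm_mixedEmbedding_gen {J : (Ideal (𝓞 K))⁰} (I : PrincipalMultiple K J) :
    mixedEmbedding.norm (mixedEmbedding K (I.gen : 𝓞 K)) = Ideal.absNorm (I.1 : Ideal (𝓞 K)) := by
  rw [norm_eq_norm, I.span_gen, Ideal.absNorm_span_singleton, ← Algebra.coe_norm_int]
  rw [Nat.cast_natAbs]
  push_cast
  rfl

/-- The nonzero points of the lattice of `J` are pairs of a principal ideal inside `J` and a unit;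
summing over the unit first collapses the cone weight. -/
theorem hasSum_principalMultiple (J : (Ideal (𝓞 K))⁰) {s : ℂ} (hs : 1 < s.re) :
    HasSum (fun I : PrincipalMultiple K J ↦
      (torsionOrder K : ℂ) * (Ideal.absNorm (I.1 : Ideal (𝓞 K)) : ℂ) ^ (-s))
      (∑' x, coneFamily K s
        (latticePoint (fractionalIdealLatticeBasis K (FractionalIdeal.mk0 K J)) x)) := by
  set b := fractionalIdealLatticeBasis K (FractionalIdeal.mk0 K J) with hb
  have hhom := isHomogeneousFamily_coneFamily (K := K)
  rw [← card_index_fractionalIdealLatticeBasis K J] at hhom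
  have : Nonempty
      (Module.Free.ChooseBasisIndex ℤ (FractionalIdeal.mk0 K J : FractionalIdeal (𝓞 K)⁰ K)) := by
    rw [← Fintype.card_pos_iff, card_index_fractionalIdealLatticeBasis]
    exact Module.finrank_pos
  have h1 := (hhom.summable b hs).hasSum
  have h2 : HasSum (fun a : (J : Ideal (𝓞 K)) ↦ coneFamily K s (mixedEmbedding K (a : 𝓞 K)))
      (∑' x, coneFamily K s (latticePoint b x)) := by
    rw [← (intCoordEquivIdeal K J).hasSum_iff]
    convert h1 using 2 with x
    simp only [Function.comp_apply, mixedEmbedding_intCoordEquivIdeal, hb]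
  have h3 : HasSum (fun a : {a : (J : Ideal (𝓞 K)) // (a : 𝓞 K) ≠ 0} ↦
      coneFamily K s (mixedEmbedding K (a.1 : 𝓞 K)))
      (∑' x, coneFamily K s (latticePoint b x)) := by
    refine (hasSum_subtype_iff_of_support_subset
      (s := {a : (J : Ideal (𝓞 K)) | (a : 𝓞 K) ≠ 0}) ?_).2 h2
    intro a ha h0
    refine ha ?_
    beta_reduce
    simp [h0, hhom.map_zero]
  have h4 := (principalMultipleProdUnitsEquiv J).hasSum_iff.2 h3
  refine h4.prod_fiberwise fun I ↦ ?_
  have hne : mixedEmbedding.norm (mixedEmbedding K (I.gen : 𝓞 K)) ≠ 0 := by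
    rw [norm_mixedEmbedding_gen]
    exact_mod_cast (Ideal.absNorm_ne_zero_of_nonZeroDivisors I.1)
  have h5 := hasSum_coneFamily_unit_smul s hne
  rw [norm_mixedEmbedding_gen, Complex.ofReal_natCast] at h5
  refine hasSum_of_forall_eq h5 fun u ↦ ?_
  change coneFamily K s (mixedEmbedding K ((u * I.gen : 𝓞 K) : K)) = _
  rw [unitSMul_smul, ← map_mul]
  rfl

/-- The ideals in the inverse of the class of `J` correspond to the principal multiples of `J`. -/
noncomputable def idealClassEquivPrincipalMultiple {C : ClassGroup (𝓞 K)} {J : (Ideal (𝓞 K))⁰}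
    (hJ : ClassGroup.mk0 J = C⁻¹) :
    {I : (Ideal (𝓞 K))⁰ // ClassGroup.mk0 I = C} ≃ PrincipalMultiple K J :=
  ((Equiv.dvd J).subtypeEquiv (q := fun I ↦ (I.1 : Ideal (𝓞 K)).IsPrincipal) fun I ↦ by
    change _ ↔ ((J * I : (Ideal (𝓞 K))⁰) : Ideal (𝓞 K)).IsPrincipal
    rw [← ClassGroup.mk0_eq_one_iff (J * I).2, Subtype.coe_eta, map_mul, hJ, inv_mul_eq_one,
      eq_comm]).trans
    (Equiv.subtypeSubtypeEquivSubtypeInter (fun I : (Ideal (𝓞 K))⁰ ↦ J ∣ I)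
      fun I ↦ (I : Ideal (𝓞 K)).IsPrincipal)

theorem coe_idealClassEquivPrincipalMultiple {C : ClassGroup (𝓞 K)} {J : (Ideal (𝓞 K))⁰}
    (hJ : ClassGroup.mk0 J = C⁻¹) (I : {I : (Ideal (𝓞 K))⁰ // ClassGroup.mk0 I = C}) :
    ((idealClassEquivPrincipalMultiple hJ I).1 : Ideal (𝓞 K)) = J * I.1 := rfl

/-- Multiplication by `J` turns the class `C` into the principal ideals inside `J`, at the cost of
the factor `N(J) ^ s`. -/
theorem hasSum_idealClass {C : ClassGroup (𝓞 K)} {J : (Ideal (𝓞 K))⁰}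
    (hJ : ClassGroup.mk0 J = C⁻¹) {s : ℂ} (hs : 1 < s.re) :
    HasSum (fun I : {I : (Ideal (𝓞 K))⁰ // ClassGroup.mk0 I = C} ↦
      (Ideal.absNorm (I.1 : Ideal (𝓞 K)) : ℂ) ^ (-s))
      ((Ideal.absNorm (J : Ideal (𝓞 K)) : ℂ) ^ s * (torsionOrder K : ℂ)⁻¹ *
        ∑' x, coneFamily K s
          (latticePoint (fractionalIdealLatticeBasis K (FractionalIdeal.mk0 K J)) x)) := by
  have h := ((idealClassEquivPrincipalMultiple hJ).hasSum_iff.2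
    (hasSum_principalMultiple J hs)).mul_left
      ((Ideal.absNorm (J : Ideal (𝓞 K)) : ℂ) ^ s * (torsionOrder K : ℂ)⁻¹)
  refine hasSum_of_forall_eq h fun I ↦ ?_
  have hJ0 : (Ideal.absNorm (J : Ideal (𝓞 K)) : ℂ) ≠ 0 := by
    exact_mod_cast Ideal.absNorm_ne_zero_of_nonZeroDivisors J
  have hw : (torsionOrder K : ℂ) ≠ 0 := by exact_mod_cast torsionOrder_ne_zero K
  rw [Function.comp_apply, coe_idealClassEquivPrincipalMultiple, map_mul, Nat.cast_mul,
    Complex.natCast_mul_natCast_cpow, Complex.cpow_neg (Ideal.absNorm (J : Ideal (𝓞 K)) : ℂ)]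
  have : (Ideal.absNorm (J : Ideal (𝓞 K)) : ℂ) ^ s ≠ 0 := by simp [Complex.cpow_eq_zero_iff, hJ0]
  field_simp

theorem summable_absNorm_cpow {s : ℂ} (hs : 1 < s.re) :
    Summable fun I : (Ideal (𝓞 K))⁰ ↦ (Ideal.absNorm (I : Ideal (𝓞 K)) : ℂ) ^ (-s) := by
  rw [← (Equiv.sigmaFiberEquiv (ClassGroup.mk0 (R := 𝓞 K))).summable_iff, ← summable_norm_iff,
    summable_sigma_of_nonneg fun _ ↦ norm_nonneg _]
  refine ⟨fun C ↦ ?_, .of_finite⟩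
  obtain ⟨J, hJ⟩ := ClassGroup.mk0_surjective C⁻¹
  exact (hasSum_idealClass hJ hs).summable.norm

/-- The Dedekind zeta function continues meromorphically to `Re s > 0`. -/
theorem exists_meromorphicOn_tsum_absNorm_cpow :
    ∃ F : ℂ → ℂ, MeromorphicOn F {s : ℂ | 0 < s.re} ∧ ∀ s : ℂ, 1 < s.re →
      F s = ∑' I : (Ideal (𝓞 K))⁰, (Ideal.absNorm (I : Ideal (𝓞 K)) : ℂ) ^ (-s) := by
  choose J hJ using fun C : ClassGroup (𝓞 K) ↦ ClassGroup.mk0_surjective C⁻¹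
  have hcont : ∀ C : ClassGroup (𝓞 K), ∃ F : ℂ → ℂ, MeromorphicOn F {s : ℂ | 0 < s.re} ∧
      ∀ s : ℂ, 1 < s.re → F s = ∑' x, coneFamily K s
        (latticePoint (fractionalIdealLatticeBasis K (FractionalIdeal.mk0 K (J C))) x) := by
    intro C
    have hhom := isHomogeneousFamily_coneFamily (K := K)
    rw [← card_index_fractionalIdealLatticeBasis K (J C)] at hhom
    have : Nonempty (Module.Free.ChooseBasisIndex ℤ
        (FractionalIdeal.mk0 K (J C) : FractionalIdeal (𝓞 K)⁰ K)) := by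
      rw [← Fintype.card_pos_iff, card_index_fractionalIdealLatticeBasis]
      exact Module.finrank_pos
    exact hhom.exists_meromorphicOn_tsum _
  choose F hF hFs using hcont
  refine ⟨fun s ↦ ∑ C, (Ideal.absNorm (J C : Ideal (𝓞 K)) : ℂ) ^ s * (torsionOrder K : ℂ)⁻¹ * F C s,
    fun s hs ↦ MeromorphicAt.fun_sum fun C _ ↦ ?_, fun s hs ↦ ?_⟩
  · refine MeromorphicAt.mul (AnalyticAt.meromorphicAt ?_) (hF C s hs)
    have hJ0 : (Ideal.absNorm (J C : Ideal (𝓞 K)) : ℂ) ≠ 0 := by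
      exact_mod_cast Ideal.absNorm_ne_zero_of_nonZeroDivisors (J C)
    have : Differentiable ℂ fun s : ℂ ↦
        (Ideal.absNorm (J C : Ideal (𝓞 K)) : ℂ) ^ s * (torsionOrder K : ℂ)⁻¹ := by
      fun_prop (disch := simp [hJ0])
    exact this.analyticAt s
  · have hsum := summable_absNorm_cpow (K := K) hs
    have hsum' := (Equiv.sigmaFiberEquiv (ClassGroup.mk0 (R := 𝓞 K))).summable_iff.2 hsum
    rw [← (Equiv.sigmaFiberEquiv (ClassGroup.mk0 (R := 𝓞 K))).tsum_eq]
    simp only [Function.comp_def] at hsum'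
    rw [hsum'.tsum_sigma' fun C ↦ (hasSum_idealClass (hJ C) hs).summable, tsum_fintype]
    refine Finset.sum_congr rfl fun C _ ↦ ?_
    rw [hFs C s hs]
    exact ((hasSum_idealClass (hJ C) hs).tsum_eq).symm

end DedekindContinuation

/-! ### Counting functions and logarithmic sums. -/

section NormCount

open Filter Topology

/-- The number of elements of norm at most `x`. -/
noncomputable def normCount {X : Type*} (ν : X → ℕ) (x : ℝ) : ℕ := Nat.card {a // (ν a : ℝ) ≤ x}

variable {X Y : Type*} {ν : X → ℕ} {μ : Y → ℕ}

theorem hasSum_normCount {x : ℝ} (hfin : {a | (ν a : ℝ) ≤ x}.Finite) :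
    HasSum (fun a ↦ if (ν a : ℝ) ≤ x then (1 : ℝ) else 0) (normCount ν x) := by
  have h := hasSum_sum_of_ne_finset_zero (L := .unconditional _)
    (f := fun a ↦ if (ν a : ℝ) ≤ x then (1 : ℝ) else 0) (s := hfin.toFinset)
    (fun a ha ↦ by simpa using ha)
  convert h using 1
  rw [Finset.sum_ite_of_true (fun a ha ↦ by simpa using ha), Finset.sum_const, nsmul_eq_mul, mul_one,
    normCount, ← Set.ncard_eq_toFinset_card _ hfin]
  rfl

theorem normCount_eq_zero (hν : ∀ a, 0 < ν a) {x : ℝ} (hx : x < 1) : normCount ν x = 0 := by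
  have : IsEmpty {a // (ν a : ℝ) ≤ x} := ⟨fun a ↦ by
    have h1 : (1 : ℝ) ≤ ν a.1 := by exact_mod_cast hν a.1
    linarith [a.2]⟩
  exact Nat.card_of_isEmpty

theorem normCount_mono (hfin : ∀ x : ℝ, {a | (ν a : ℝ) ≤ x}.Finite) : Monotone (normCount ν) := by
  intro x y hxy
  have : Finite {a // (ν a : ℝ) ≤ y} := hfin y
  exact Nat.card_le_card_of_injective (fun a ↦ ⟨a.1, a.2.trans hxy⟩ : {a // (ν a : ℝ) ≤ x} → _)
    fun a b h ↦ Subtype.ext (by simpa using h)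

theorem normCount_equiv (e : X ≃ Y) (he : ∀ a, μ (e a) = ν a) (x : ℝ) :
    normCount μ x = normCount ν x :=
  (Nat.card_congr (e.subtypeEquiv fun a ↦ by rw [he])).symm

theorem finite_prod_norm_le (hν : ∀ a, 0 < ν a) (hμ : ∀ b, 0 < μ b)
    (hνf : ∀ x : ℝ, {a | (ν a : ℝ) ≤ x}.Finite) (hμf : ∀ x : ℝ, {b | (μ b : ℝ) ≤ x}.Finite) (x : ℝ) :
    {p : X × Y | ((ν p.1 * μ p.2 : ℕ) : ℝ) ≤ x}.Finite := by
  refine ((hνf x).prod (hμf x)).subset fun p hp ↦ ?_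
  simp only [Set.mem_ofPred_eq] at hp
  exact ⟨(Nat.cast_le.2 (Nat.le_mul_of_pos_right _ (hμ _))).trans hp,
    (Nat.cast_le.2 (Nat.le_mul_of_pos_left _ (hν _))).trans hp⟩

theorem hasSum_normCount_prod (hν : ∀ a, 0 < ν a) (hμ : ∀ b, 0 < μ b)
    (hνf : ∀ x : ℝ, {a | (ν a : ℝ) ≤ x}.Finite) (hμf : ∀ x : ℝ, {b | (μ b : ℝ) ≤ x}.Finite) (x : ℝ) :
    HasSum (fun a ↦ (normCount μ (x / ν a) : ℝ))
      (normCount (fun p : X × Y ↦ ν p.1 * μ p.2) x) := by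
  refine (hasSum_normCount (finite_prod_norm_le hν hμ hνf hμf x)).prod_fiberwise fun a ↦ ?_
  convert hasSum_normCount (hμf (x / ν a)) using 3 with b
  have : (0 : ℝ) < ν a := by exact_mod_cast hν a
  rw [le_div_iff₀' this]
  push_cast
  rfl

theorem hasSum_normCount_prod' (hν : ∀ a, 0 < ν a) (hμ : ∀ b, 0 < μ b)
    (hνf : ∀ x : ℝ, {a | (ν a : ℝ) ≤ x}.Finite) (hμf : ∀ x : ℝ, {b | (μ b : ℝ) ≤ x}.Finite) (x : ℝ) :
    HasSum (fun b ↦ (normCount ν (x / μ b) : ℝ))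
      (normCount (fun p : X × Y ↦ ν p.1 * μ p.2) x) := by
  rw [normCount_equiv (ν := fun p : Y × X ↦ μ p.1 * ν p.2) (Equiv.prodComm Y X)
    fun p ↦ by simp [mul_comm]]
  exact hasSum_normCount_prod hμ hν hμf hνf x

theorem normCount_pnat {x : ℝ} (hx : 0 ≤ x) : normCount (fun n : ℕ+ ↦ (n : ℕ)) x = ⌊x⌋₊ := by
  have e : {n : ℕ+ // ((n : ℕ) : ℝ) ≤ x} ≃ Finset.Icc 1 ⌊x⌋₊ :=
    { toFun := fun n ↦ ⟨n.1, Finset.mem_Icc.2 ⟨n.1.pos, Nat.le_floor n.2⟩⟩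
      invFun := fun n ↦ ⟨⟨n.1, (Finset.mem_Icc.1 n.2).1⟩,
        (Nat.le_floor_iff hx).1 (Finset.mem_Icc.1 n.2).2⟩
      left_inv := fun n ↦ rfl
      right_inv := fun n ↦ rfl }
  rw [normCount, Nat.card_congr e, Nat.card_eq_fintype_card, Fintype.card_coe, Nat.card_Icc]
  simp

theorem finite_pnat_le (x : ℝ) : {n : ℕ+ | ((n : ℕ) : ℝ) ≤ x}.Finite := by
  refine Set.Finite.of_finite_image (f := fun n : ℕ+ ↦ (n : ℕ)) ?_ PNat.coe_injective.injOn
  refine (Set.finite_Iic ⌊x⌋₊).subset ?_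
  rintro _ ⟨n, hn, rfl⟩
  exact Nat.le_floor hn

/-- An asymptotic formula on `[1, ∞)` with an error term that is uniform. -/
theorem exists_abs_normCount_sub_le (hfin : ∀ x : ℝ, {a | (ν a : ℝ) ≤ x}.Finite) {j : ℕ} {c : ℝ}
    (h : Tendsto (fun x : ℝ ↦ normCount ν x / (x * Real.log x ^ j)) atTop (𝓝 c))
    {ε : ℝ} (hε : 0 < ε) : ∃ C : ℝ, 0 ≤ C ∧ ∀ t : ℝ, 1 ≤ t →
      |normCount ν t - c * (t * Real.log t ^ j)| ≤ ε * (t * Real.log t ^ j) + C := by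
  have hev : ∀ᶠ t : ℝ in atTop, |(normCount ν t : ℝ) / (t * Real.log t ^ j) - c| < ε :=
    (tendsto_iff_norm_sub_tendsto_zero.1 h).eventually_lt_const hε
  obtain ⟨T, hT⟩ := eventually_atTop.1 (hev.and (eventually_gt_atTop 1))
  have hT1 : 1 < T := (hT T le_rfl).2
  -- The constant absorbs `[1, T]`, where the count and the main term are both bounded by their
  -- values at `T`.
  refine ⟨normCount ν T + |c| * (T * Real.log T ^ j), ?_, fun t ht ↦ ?_⟩
  · have := Real.log_nonneg hT1.le
    positivity
  have hlog := Real.log_nonneg ht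
  have hlogT := Real.log_nonneg hT1.le
  rcases le_total T t with h1 | h1
  · have ht1 := (hT t h1).2
    have hpos : 0 < t * Real.log t ^ j := mul_pos (by linarith) (pow_pos (Real.log_pos ht1) _)
    have h2 := (hT t h1).1.le
    rw [div_sub' hpos.ne', abs_div, abs_of_pos hpos, div_le_iff₀ hpos, mul_comm _ c] at h2
    have : 0 ≤ (normCount ν T : ℝ) + |c| * (T * Real.log T ^ j) := by positivity
    linarith
  · have h2 : (normCount ν t : ℝ) ≤ normCount ν T := by exact_mod_cast normCount_mono hfin h1
    have h3 : t * Real.log t ^ j ≤ T * Real.log T ^ j := by gcongr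
    calc |(normCount ν t : ℝ) - c * (t * Real.log t ^ j)|
        ≤ |(normCount ν t : ℝ)| + |c * (t * Real.log t ^ j)| := abs_sub _ _
      _ = normCount ν t + |c| * (t * Real.log t ^ j) := by
        rw [abs_mul, abs_of_nonneg (by positivity : (0 : ℝ) ≤ normCount ν t),
          abs_of_nonneg (by positivity : 0 ≤ t * Real.log t ^ j)]
      _ ≤ normCount ν T + |c| * (T * Real.log T ^ j) := by gcongr
      _ ≤ _ := by
        have : 0 ≤ ε * (t * Real.log t ^ j) := by positivity
        linarith

/-- `P` has the order of `φ` but comes with an arbitrarily small coefficient, and `Q` is of lower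
order, so `f - g = o(φ)`. -/
theorem tendsto_div_of_abs_sub_le {f g P Q φ : ℝ → ℝ} {p l : ℝ} (hφ : ∀ᶠ x in atTop, 0 < φ x)
    (hP : Tendsto (fun x ↦ P x / φ x) atTop (𝓝 p)) (hQ : Tendsto (fun x ↦ Q x / φ x) atTop (𝓝 0))
    (h : ∀ ε > 0, ∃ C : ℝ, ∀ᶠ x in atTop, |f x - g x| ≤ ε * P x + C * Q x)
    (hg : Tendsto (fun x ↦ g x / φ x) atTop (𝓝 l)) :
    Tendsto (fun x ↦ f x / φ x) atTop (𝓝 l) := by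
  have key : Tendsto (fun x ↦ f x / φ x - g x / φ x) atTop (𝓝 0) := by
    rw [Metric.tendsto_nhds]
    intro ε hε
    have hp : 0 < |p| + 1 := by positivity
    obtain ⟨C, hC⟩ := h (ε / (2 * (|p| + 1))) (by positivity)
    have h1 : Tendsto (fun x ↦ ε / (2 * (|p| + 1)) * (P x / φ x) + C * (Q x / φ x)) atTop
        (𝓝 (ε / (2 * (|p| + 1)) * p + C * 0)) := (hP.const_mul _).add (hQ.const_mul _)
    have hlt : ε / (2 * (|p| + 1)) * p + C * 0 < ε := by
      have : ε / (2 * (|p| + 1)) * p ≤ ε / (2 * (|p| + 1)) * (|p| + 1) := by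
        gcongr
        linarith [le_abs_self p]
      have h2 : ε / (2 * (|p| + 1)) * (|p| + 1) = ε / 2 := by field_simp
      linarith
    filter_upwards [hφ, hC, h1.eventually_lt_const hlt] with x hx1 hx2 hx3
    rw [dist_zero_right, Real.norm_eq_abs, ← sub_div, abs_div, abs_of_pos hx1]
    refine lt_of_le_of_lt ?_ hx3
    rw [div_le_iff₀ hx1]
    refine hx2.trans (le_of_eq ?_)
    field_simp
  simpa using key.add hg

theorem tendsto_log_pow_div_log_pow_succ (j : ℕ) :
    Tendsto (fun x : ℝ ↦ Real.log x ^ j / Real.log x ^ (j + 1)) atTop (𝓝 0) := by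
  refine (tendsto_inv_atTop_zero.comp Real.tendsto_log_atTop).congr' ?_
  filter_upwards [eventually_gt_atTop 1] with x hx
  have := Real.log_pos hx
  simp only [Function.comp_apply]
  field_simp
  ring

/-- The weighted sum `∑_{n ≤ x} log(x / n) ^ j / n` is asymptotic to `log(x) ^ (j + 1) / (j + 1)`. -/
theorem tendsto_sum_log_div_pow (j : ℕ) :
    Tendsto (fun x : ℝ ↦ (∑ n ∈ Finset.Icc 1 ⌊x⌋₊, x / n * Real.log (x / n) ^ j) /
      (x * Real.log x ^ (j + 1))) atTop (𝓝 (1 / (j + 1))) := by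
  -- Mean value bounds for `y ^ (j + 1)`, read off from the factorization of a difference of powers.
  have hmvt : ∀ a b : ℝ, 0 ≤ b → b ≤ a → (j + 1) * b ^ j * (a - b) ≤ a ^ (j + 1) - b ^ (j + 1) ∧
      a ^ (j + 1) - b ^ (j + 1) ≤ (j + 1) * a ^ j * (a - b) := by
    intro a b hb hab
    have ha := hb.trans hab
    have hgeom := geom_sum₂_mul a b (j + 1)
    rw [← hgeom]
    have hcard : ∀ y : ℝ, ((j : ℝ) + 1) * y ^ j = ∑ i ∈ Finset.range (j + 1), y ^ i * y ^ (j - i) := by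
      intro y
      rw [Finset.sum_congr rfl fun i hi ↦ by
        rw [← pow_add, Nat.add_sub_cancel' (Nat.lt_succ_iff.1 (Finset.mem_range.1 hi))]]
      simp
    rw [hcard, hcard]
    constructor
    · refine mul_le_mul_of_nonneg_right (Finset.sum_le_sum fun i _ ↦ ?_) (by linarith)
      simp only [Nat.add_sub_cancel]
      gcongr
    · refine mul_le_mul_of_nonneg_right (Finset.sum_le_sum fun i _ ↦ ?_) (by linarith)
      simp only [Nat.add_sub_cancel]
      gcongr
  have hj : (0 : ℝ) < j + 1 := by positivity
  have hstep : ∀ n : ℕ, 1 ≤ n → 1 / ((n : ℝ) + 1) ≤ Real.log (n + 1) - Real.log n ∧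
      Real.log (n + 1) - Real.log n ≤ 1 / n := by
    intro n hn
    have hn0 : (0 : ℝ) < n := by exact_mod_cast hn
    constructor
    · rw [← Real.log_div (by positivity) (by positivity)]
      have := Real.one_sub_inv_le_log_of_pos (x := ((n : ℝ) + 1) / n) (by positivity)
      refine le_trans (le_of_eq ?_) this
      field_simp
      ring
    · rw [← Real.log_div (by positivity) (by positivity)]
      have := Real.log_le_sub_one_of_pos (x := ((n : ℝ) + 1) / n) (by positivity)
      refine this.trans (le_of_eq ?_)
      field_simp
      ring
  have hdiff : ∀ (x : ℝ) (n : ℕ), 0 < x → 1 ≤ n →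
      Real.log (x / n) - Real.log (x / (n + 1 : ℕ)) = Real.log (n + 1) - Real.log n := by
    intro x n hx hn
    have hn0 : (0 : ℝ) < n := by exact_mod_cast hn
    rw [Real.log_div hx.ne' hn0.ne', Real.log_div hx.ne' (by positivity)]
    push_cast
    ring
  -- Comparison with `∫ log(x/u) ^ j du/u` done by telescoping `hmvt` over consecutive values
  -- `log(x/n)`. The extra `log x ^ j` is the summand `n = 1`.
  have hupper : ∀ (x : ℝ), 1 ≤ x → ∀ N : ℕ, ((N + 1 : ℕ) : ℝ) ≤ x →
      ∑ n ∈ Finset.Icc 1 (N + 1), 1 / (n : ℝ) * Real.log (x / n) ^ j ≤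
        Real.log x ^ j +
          (Real.log x ^ (j + 1) - Real.log (x / (N + 1 : ℕ)) ^ (j + 1)) / (j + 1) := by
    intro x hx N
    induction N with
    | zero => simp
    | succ N ih =>
      intro hN
      rw [Finset.sum_Icc_succ_top (by lia)]
      have hN1 : ((N + 1 : ℕ) : ℝ) ≤ x := le_trans (by push_cast; linarith) hN
      have hN' : (0 : ℝ) < ((N + 1 + 1 : ℕ) : ℝ) := by positivity
      have hb : 0 ≤ Real.log (x / (N + 1 + 1 : ℕ)) := Real.log_nonneg ((one_le_div hN').2 hN)
      have hd := hdiff x (N + 1) (by linarith) (by lia)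
      have hs := (hstep (N + 1) (by lia)).1
      have hs' : 0 ≤ 1 / (((N + 1 : ℕ) : ℝ) + 1) := by positivity
      have hm := (hmvt (Real.log (x / (N + 1 : ℕ))) _ hb (by linarith)).1
      rw [hd] at hm
      have h1 : (j + 1) * (1 / ((N + 1 + 1 : ℕ) : ℝ) * Real.log (x / (N + 1 + 1 : ℕ)) ^ j) ≤
          Real.log (x / (N + 1 : ℕ)) ^ (j + 1) - Real.log (x / (N + 1 + 1 : ℕ)) ^ (j + 1) := by
        refine le_trans ?_ hm
        rw [mul_comm (1 / _), ← mul_assoc]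
        refine mul_le_mul_of_nonneg_left ?_ (by positivity)
        push_cast at hs ⊢
        exact hs
      rw [← le_div_iff₀' hj] at h1
      have := ih hN1
      rw [sub_div] at this h1 ⊢
      linarith
  have hlower : ∀ (x : ℝ), 1 ≤ x → ∀ N : ℕ, ((N + 1 : ℕ) : ℝ) ≤ x →
      (Real.log x ^ (j + 1) - Real.log (x / (N + 1 : ℕ)) ^ (j + 1)) / (j + 1) ≤
        ∑ n ∈ Finset.Icc 1 (N + 1), 1 / (n : ℝ) * Real.log (x / n) ^ j := by
    intro x hx N hNx
    -- The telescoping uses only the summands up to `N`; the last one is nonnegative.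
    refine le_trans (b := ∑ n ∈ Finset.Icc 1 N, 1 / (n : ℝ) * Real.log (x / n) ^ j) ?_ ?_
    · induction N with
      | zero => simp
      | succ N ih =>
        rw [Finset.sum_Icc_succ_top (by lia)]
        have hN1 : ((N + 1 : ℕ) : ℝ) ≤ x := le_trans (by push_cast; linarith) hNx
        have hN' : (0 : ℝ) < ((N + 1 + 1 : ℕ) : ℝ) := by positivity
        have hb : 0 ≤ Real.log (x / (N + 1 + 1 : ℕ)) := Real.log_nonneg ((one_le_div hN').2 hNx)
        have hd := hdiff x (N + 1) (by linarith) (by lia)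
        have hs := (hstep (N + 1) (by lia)).2
        have hs0 := (hstep (N + 1) (by lia)).1
        have hs' : 0 ≤ 1 / (((N + 1 : ℕ) : ℝ) + 1) := by positivity
        have hab : Real.log (x / (N + 1 + 1 : ℕ)) ≤ Real.log (x / (N + 1 : ℕ)) := by linarith
        have ha := hb.trans hab
        have hm := (hmvt (Real.log (x / (N + 1 : ℕ))) _ hb hab).2
        rw [hd] at hm
        have h1 : Real.log (x / (N + 1 : ℕ)) ^ (j + 1) - Real.log (x / (N + 1 + 1 : ℕ)) ^ (j + 1) ≤
            (j + 1) * (1 / ((N + 1 : ℕ) : ℝ) * Real.log (x / (N + 1 : ℕ)) ^ j) := by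
          refine hm.trans ?_
          rw [mul_comm (1 / _), ← mul_assoc]
          exact mul_le_mul_of_nonneg_left hs (by positivity)
        rw [← div_le_iff₀' hj] at h1
        have := ih hN1
        rw [sub_div] at this h1 ⊢
        linarith
    · refine Finset.sum_le_sum_of_subset_of_nonneg (Finset.Icc_subset_Icc_right (by lia)) ?_
      intro n hn _
      have hn0 : (0 : ℝ) < n := by exact_mod_cast (Finset.mem_Icc.1 hn).1
      have hnx : (n : ℝ) ≤ x := le_trans (by exact_mod_cast (Finset.mem_Icc.1 hn).2) hNx
      have := Real.log_nonneg ((one_le_div hn0).2 hnx)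
      positivity
  have hlim1 : Tendsto (fun x : ℝ ↦ 1 / ((j : ℝ) + 1) - 1 / (j + 1) / Real.log x ^ (j + 1)) atTop
      (𝓝 (1 / (j + 1))) := by
    have := ((tendsto_pow_atTop (Nat.succ_ne_zero j)).comp Real.tendsto_log_atTop).const_div_atTop
      (1 / ((j : ℝ) + 1))
    simpa using tendsto_const_nhds.sub this
  have hlim2 : Tendsto (fun x : ℝ ↦ Real.log x ^ j / Real.log x ^ (j + 1) + 1 / ((j : ℝ) + 1)) atTop
      (𝓝 (1 / (j + 1))) := by
    simpa using (tendsto_log_pow_div_log_pow_succ j).add_const (1 / ((j : ℝ) + 1))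
  have hcancel : ∀ x : ℝ, 1 < x →
      (∑ n ∈ Finset.Icc 1 ⌊x⌋₊, x / n * Real.log (x / n) ^ j) / (x * Real.log x ^ (j + 1)) =
      (∑ n ∈ Finset.Icc 1 ⌊x⌋₊, 1 / (n : ℝ) * Real.log (x / n) ^ j) / Real.log x ^ (j + 1) := by
    intro x hx
    rw [← mul_div_mul_left _ (Real.log x ^ (j + 1)) (by linarith : x ≠ 0), Finset.mul_sum]
    congr 1
    exact Finset.sum_congr rfl fun n _ ↦ by ring
  refine tendsto_of_tendsto_of_tendsto_of_le_of_le' hlim1 hlim2 ?_ ?_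
  all_goals
    filter_upwards [eventually_gt_atTop 1] with x hx
    rw [hcancel x hx]
    have hL : 0 < Real.log x ^ (j + 1) := pow_pos (Real.log_pos hx) _
    obtain ⟨N, hN⟩ : ∃ N, ⌊x⌋₊ = N + 1 :=
      Nat.exists_eq_succ_of_ne_zero (Nat.floor_pos.2 hx.le).ne'
    have hNx : ((N + 1 : ℕ) : ℝ) ≤ x := hN ▸ Nat.floor_le (by linarith)
    have hN' : (0 : ℝ) < ((N + 1 : ℕ) : ℝ) := by positivity
    have h0 : 0 ≤ Real.log (x / (N + 1 : ℕ)) := Real.log_nonneg ((one_le_div hN').2 hNx)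
    rw [hN]
  -- With `N + 1 = ⌊x⌋` the quotient is at most `2`, so the boundary term left by telescoping stays
  -- bounded.
  · have h1 : Real.log (x / (N + 1 : ℕ)) ^ (j + 1) ≤ 1 := by
      refine pow_le_one₀ h0 ?_
      have h2 : x < ((N + 1 : ℕ) : ℝ) + 1 := hN ▸ Nat.lt_floor_add_one x
      have h3 : x / (N + 1 : ℕ) ≤ 2 := by
        rw [div_le_iff₀ hN']
        push_cast at h2 ⊢
        linarith [(by positivity : (0 : ℝ) ≤ N)]
      have h4 := Real.log_le_sub_one_of_pos (x := x / (N + 1 : ℕ)) (by positivity)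
      linarith
    rw [le_div_iff₀ hL]
    refine le_trans ?_ (hlower x hx.le N hNx)
    rw [sub_mul, div_mul_cancel₀ _ hL.ne', sub_div, div_mul_eq_mul_div, one_mul]
    gcongr
  · rw [div_le_iff₀ hL]
    refine (hupper x hx.le N hNx).trans ?_
    rw [add_mul, div_mul_cancel₀ _ hL.ne', div_mul_eq_mul_div, one_mul]
    gcongr
    exact sub_le_self _ (pow_nonneg h0 _)

end NormCount

/-! ### Asymptotics for products and for complements. -/

section NormCountProduct

open Filter Topology

variable {X Y : Type*} {ν : X → ℕ} {μ : Y → ℕ}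

theorem normCount_prod_eq_sum (hν : ∀ a, 0 < ν a) (hνf : ∀ x : ℝ, {a | (ν a : ℝ) ≤ x}.Finite)
    (hμ : ∀ b, 0 < μ b) (hμf : ∀ x : ℝ, {b | (μ b : ℝ) ≤ x}.Finite) (x : ℝ) (hx : 0 < x) :
    (normCount (fun p : X × Y ↦ ν p.1 * μ p.2) x : ℝ) =
      ∑ a ∈ (hνf x).toFinset, (normCount μ (x / ν a) : ℝ) := by
  rw [← (hasSum_normCount_prod hν hμ hνf hμf x).tsum_eq]
  refine tsum_eq_sum fun a ha ↦ ?_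
  have h1 : x < ν a := by simpa using ha
  rw [normCount_eq_zero hμ, Nat.cast_zero]
  rwa [div_lt_one (hx.trans h1)]

/-- If `X` has `~ c x log(x) ^ j` elements of norm at most `x` and `Y` has `~ c' x`, then `X × Y` has
`~ c c' / (j + 1) x log(x) ^ (j + 1)`. -/
theorem tendsto_normCount_prod (hν : ∀ a, 0 < ν a) (hμ : ∀ b, 0 < μ b)
    (hνf : ∀ x : ℝ, {a | (ν a : ℝ) ≤ x}.Finite) (hμf : ∀ x : ℝ, {b | (μ b : ℝ) ≤ x}.Finite)
    {j : ℕ} {c c' : ℝ}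
    (h : Tendsto (fun x : ℝ ↦ normCount ν x / (x * Real.log x ^ j)) atTop (𝓝 c))
    (h' : Tendsto (fun x : ℝ ↦ normCount μ x / x) atTop (𝓝 c')) :
    Tendsto (fun x : ℝ ↦ normCount (fun p : X × Y ↦ ν p.1 * μ p.2) x / (x * Real.log x ^ (j + 1)))
      atTop (𝓝 (c' * (c * (1 / (j + 1))))) := by
  set W : ℝ → ℝ := fun x ↦ ∑ n ∈ Finset.Icc 1 ⌊x⌋₊, x / n * Real.log (x / n) ^ j with hW
  set S : ℝ → ℝ := fun x ↦ ∑ a ∈ (hνf x).toFinset, x / ν a with hS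
  have hφ : ∀ᶠ x : ℝ in atTop, 0 < x * Real.log x ^ (j + 1) := by
    filter_upwards [eventually_gt_atTop 1] with x hx
    exact mul_pos (by linarith) (pow_pos (Real.log_pos hx) _)
  have hWlim := tendsto_sum_log_div_pow j
  have hxlim : Tendsto (fun x : ℝ ↦ x / (x * Real.log x ^ (j + 1))) atTop (𝓝 0) := by
    have := ((tendsto_pow_atTop (Nat.succ_ne_zero j)).comp
      Real.tendsto_log_atTop).const_div_atTop (1 : ℝ)
    refine this.congr' ?_
    filter_upwards [eventually_gt_atTop 1] with x hx
    have : x ≠ 0 := by linarith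
    simp only [Function.comp_apply]
    field_simp
  have hNlim : Tendsto (fun x : ℝ ↦ normCount ν x / (x * Real.log x ^ (j + 1))) atTop (𝓝 0) := by
    have := h.mul (tendsto_log_pow_div_log_pow_succ j)
    rw [mul_zero] at this
    refine this.congr' ?_
    filter_upwards [eventually_gt_atTop 1] with x hx
    have := Real.log_pos hx
    have : x ≠ 0 := by linarith
    field_simp
  have hmem : ∀ x a, a ∈ (hνf x).toFinset → 1 ≤ x / ν a := by
    intro x a ha
    have h1 : (0 : ℝ) < ν a := by exact_mod_cast hν a
    rw [one_le_div h1]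
    simpa using ha
  have hcard : ∀ x : ℝ, ((hνf x).toFinset.card : ℝ) = normCount ν x := by
    intro x
    rw [normCount, ← Set.ncard_eq_toFinset_card _ (hνf x)]
    rfl
  -- The model case `Y = ℕ+`. Summing over `n` first, the hypothesis on `X` reduces the count to `c
  -- W(x)`, avoiding Abel summation.
  have hpnat : Tendsto (fun x : ℝ ↦ normCount (fun p : X × ℕ+ ↦ ν p.1 * (p.2 : ℕ)) x /
      (x * Real.log x ^ (j + 1))) atTop (𝓝 (c * (1 / (j + 1)))) := by
    refine tendsto_div_of_abs_sub_le (g := fun x ↦ c * W x) (P := W) (Q := id) hφ hWlim hxlim ?_ ?_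
    · intro ε hε
      obtain ⟨C, hC0, hC⟩ := exists_abs_normCount_sub_le hνf h hε
      refine ⟨C, ?_⟩
      filter_upwards [eventually_ge_atTop 1] with x hx
      have hsum : (normCount (fun p : X × ℕ+ ↦ ν p.1 * (p.2 : ℕ)) x : ℝ) =
          ∑ n ∈ Finset.Icc 1 ⌊x⌋₊, (normCount ν (x / n) : ℝ) := by
        have h1 := hasSum_normCount_prod' hν (fun n : ℕ+ ↦ n.pos) hνf finite_pnat_le x
        rw [← h1.tsum_eq, tsum_eq_sum (s := (finite_pnat_le x).toFinset)]
        · refine Finset.sum_bij (fun n _ ↦ (n : ℕ)) (fun n hn ↦ ?_)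
            (fun _ _ _ _ h ↦ PNat.coe_injective h) (fun n hn ↦ ?_) (fun _ _ ↦ rfl)
          · exact Finset.mem_Icc.2 ⟨n.pos, Nat.le_floor (by simpa using hn)⟩
          · obtain ⟨hn1, hn2⟩ := Finset.mem_Icc.1 hn
            refine ⟨⟨n, hn1⟩, ?_, rfl⟩
            exact (finite_pnat_le x).mem_toFinset.2 ((Nat.le_floor_iff (by linarith)).1 hn2)
        · intro n hn
          have h2 : x < (n : ℕ) := by simpa using hn
          rw [normCount_eq_zero hν, Nat.cast_zero]
          rwa [div_lt_one (by linarith)]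
      rw [hsum, hW]
      dsimp only
      rw [Finset.mul_sum, ← Finset.sum_sub_distrib, Finset.mul_sum]
      refine (Finset.abs_sum_le_sum_abs _ _).trans ((Finset.sum_le_sum (g := fun n : ℕ ↦
        ε * (x / n * Real.log (x / n) ^ j) + C) fun n hn ↦ ?_).trans ?_)
      · obtain ⟨hn1, hn2⟩ := Finset.mem_Icc.1 hn
        have hn0 : (0 : ℝ) < n := by exact_mod_cast hn1
        refine hC _ ((one_le_div hn0).2 ((Nat.le_floor_iff (by linarith)).1 hn2))
      · rw [Finset.sum_add_distrib]
        gcongr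
        simp only [Finset.sum_const, Nat.card_Icc, Nat.add_sub_cancel, nsmul_eq_mul, id]
        rw [mul_comm]
        gcongr
        exact Nat.floor_le (by linarith)
    · simpa only [mul_div_assoc] using hWlim.const_mul c
  -- Summing over `X` first, the same count is `∑ ⌊x / ν a⌋`. Dropping the floors costs at most one
  -- for each `a`, which is of lower order; this evaluates `S`.
  have hSlim : Tendsto (fun x : ℝ ↦ S x / (x * Real.log x ^ (j + 1))) atTop
      (𝓝 (c * (1 / (j + 1)))) := by
    refine tendsto_div_of_abs_sub_le (P := fun _ ↦ 0) (p := 0) (Q := fun x ↦ normCount ν x) hφ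
      (by simp) hNlim ?_ hpnat
    intro ε hε
    refine ⟨1, ?_⟩
    filter_upwards [eventually_ge_atTop 1] with x hx
    rw [normCount_prod_eq_sum hν hνf (fun n : ℕ+ ↦ n.pos) finite_pnat_le x (by linarith), hS]
    dsimp only
    rw [← Finset.sum_sub_distrib, mul_zero, zero_add, one_mul, ← hcard, ← nsmul_one,
      ← Finset.sum_const]
    refine (Finset.abs_sum_le_sum_abs _ _).trans (Finset.sum_le_sum fun a ha ↦ ?_)
    have h1 := hmem x a ha
    rw [normCount_pnat (by linarith), abs_le]
    have h2 := Nat.floor_le (show 0 ≤ x / ν a by linarith)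
    have h3 := Nat.lt_floor_add_one (x / ν a)
    constructor <;> linarith
  -- For general `Y`, each inner count is `c' x / ν a` up to a small multiple of `x / ν a` and a
  -- constant.
  refine tendsto_div_of_abs_sub_le (g := fun x ↦ c' * S x) (P := S)
    (Q := fun x ↦ normCount ν x) hφ hSlim hNlim ?_ ?_
  · intro ε hε
    obtain ⟨C, hC0, hC⟩ := exists_abs_normCount_sub_le (j := 0) hμf (by simpa using h') hε
    refine ⟨C, ?_⟩
    filter_upwards [eventually_ge_atTop 1] with x hx
    rw [normCount_prod_eq_sum hν hνf hμ hμf x (by linarith), hS]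
    dsimp only
    rw [Finset.mul_sum, ← Finset.sum_sub_distrib, Finset.mul_sum, ← hcard, mul_comm C,
      ← nsmul_eq_mul, ← Finset.sum_const, ← Finset.sum_add_distrib]
    refine (Finset.abs_sum_le_sum_abs _ _).trans (Finset.sum_le_sum fun a ha ↦ ?_)
    simpa using hC _ (hmem x a ha)
  · simpa only [mul_div_assoc] using hSlim.const_mul c'

/-- Multiplying by a set with convergent `∑ 1 / ν` only changes the constant in the counting
asymptotics. -/
theorem tendsto_normCount_prod_of_summable (hν : ∀ a, 0 < ν a) (hμ : ∀ b, 0 < μ b)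
    (hνf : ∀ x : ℝ, {a | (ν a : ℝ) ≤ x}.Finite) (hμf : ∀ x : ℝ, {b | (μ b : ℝ) ≤ x}.Finite)
    (hsum : Summable fun b ↦ (μ b : ℝ)⁻¹) {j : ℕ} {c : ℝ}
    (h : Tendsto (fun x : ℝ ↦ normCount ν x / (x * Real.log x ^ j)) atTop (𝓝 c)) :
    Tendsto (fun x : ℝ ↦ normCount (fun p : X × Y ↦ ν p.1 * μ p.2) x / (x * Real.log x ^ j))
      atTop (𝓝 (∑' b, c * (μ b : ℝ)⁻¹)) := by
  obtain ⟨C, hC0, hC⟩ := exists_abs_normCount_sub_le hνf h one_pos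
  have hev : ∀ x : ℝ, (normCount (fun p : X × Y ↦ ν p.1 * μ p.2) x : ℝ) / (x * Real.log x ^ j) =
      ∑' b, (normCount ν (x / μ b) : ℝ) / (x * Real.log x ^ j) := fun x ↦ by
    rw [tsum_div_const, (hasSum_normCount_prod' hν hμ hνf hμf x).tsum_eq]
  simp only [hev]
  -- Each fibre over `b` has the asymptotics of `X` at `x / μ b`, with `log(x / μ b) ~ log x`; `∑ 1
  -- / μ b` dominates.
  refine tendsto_tsum_of_dominated_convergence (bound := fun b ↦ (|c| + 1 + C) * (μ b : ℝ)⁻¹)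
    (hsum.mul_left _) (fun b ↦ ?_) ?_
  · have hb : (0 : ℝ) < μ b := by exact_mod_cast hμ b
    have h1 : Tendsto (fun x : ℝ ↦ x / μ b) atTop atTop := tendsto_id.atTop_div_const hb
    have h2 : Tendsto (fun x : ℝ ↦ Real.log (x / μ b) / Real.log x) atTop (𝓝 1) := by
      have h3 : Tendsto (fun x : ℝ ↦ 1 - Real.log (μ b) / Real.log x) atTop (𝓝 1) := by
        simpa using tendsto_const_nhds.sub
          (Real.tendsto_log_atTop.const_div_atTop (Real.log (μ b)))
      refine h3.congr' ?_
      filter_upwards [eventually_gt_atTop 1] with x hx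
      have := (Real.log_pos hx).ne'
      rw [Real.log_div (by linarith) hb.ne']
      field_simp
    have h4 := ((h.comp h1).mul ((h2.pow j).mul_const (μ b : ℝ)⁻¹))
    rw [one_pow, one_mul] at h4
    refine h4.congr' ?_
    filter_upwards [eventually_gt_atTop 1, eventually_gt_atTop (μ b : ℝ)] with x hx hx'
    have h5 : Real.log x ≠ 0 := (Real.log_pos hx).ne'
    have h6 : Real.log (x / μ b) ≠ 0 := (Real.log_pos ((one_lt_div hb).2 hx')).ne'
    have h7 : x ≠ 0 := by linarith
    simp only [Function.comp_apply]
    rw [div_pow]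
    field_simp
  -- From `e` on, `log x ≥ 1`, so the additive constant `C` is absorbed into the main term whenever
  -- `x / μ b ≥ 1`; below that the count is zero.
  · filter_upwards [eventually_ge_atTop (Real.exp 1)] with x hx b
    have hx0 : 0 < x := (Real.exp_pos 1).trans_le hx
    have hL : 1 ≤ Real.log x := by rwa [Real.le_log_iff_exp_le hx0]
    have hb : (1 : ℝ) ≤ μ b := by exact_mod_cast hμ b
    have hφ : 0 < x * Real.log x ^ j := by positivity
    rw [Real.norm_of_nonneg (by positivity), div_le_iff₀ hφ]
    rcases lt_or_ge (x / μ b) 1 with h1 | h1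
    · rw [normCount_eq_zero hν h1, Nat.cast_zero]
      positivity
    · have h2 := (abs_le.1 (hC _ h1)).2
      have h3 : Real.log (x / μ b) ≤ Real.log x :=
        Real.log_le_log (by linarith) (div_le_self hx0.le hb)
      have h0 := Real.log_nonneg h1
      have h4 : x / μ b * Real.log (x / μ b) ^ j ≤ x / μ b * Real.log x ^ j := by gcongr
      have h5 : C ≤ C * (x / μ b * Real.log x ^ j) :=
        le_mul_of_one_le_right hC0 (one_le_mul_of_one_le_of_one_le h1 (one_le_pow₀ hL))
      have h6 : c * (x / μ b * Real.log (x / μ b) ^ j) ≤ |c| * (x / μ b * Real.log x ^ j) := by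
        refine (mul_le_mul_of_nonneg_right (le_abs_self c) (by positivity)).trans ?_
        gcongr
      calc (normCount ν (x / μ b) : ℝ)
          ≤ |c| * (x / μ b * Real.log x ^ j) + 1 * (x / μ b * Real.log x ^ j) +
            C * (x / μ b * Real.log x ^ j) := by linarith
        _ = (|c| + 1 + C) * (μ b : ℝ)⁻¹ * (x * Real.log x ^ j) := by ring

/-- If the elements of `X` satisfying `p` make up a copy of `X` with norms multiplied by `q`, then
removing them multiplies the density by `1 - 1 / q`. -/
theorem tendsto_normCount_subtype (hνf : ∀ x : ℝ, {a | (ν a : ℝ) ≤ x}.Finite) {p : X → Prop} {q : ℕ}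
    (hq : 0 < q) (e : X ≃ {a // p a}) (he : ∀ a, ν (e a) = q * ν a) {c : ℝ}
    (h : Tendsto (fun x : ℝ ↦ normCount ν x / x) atTop (𝓝 c)) :
    Tendsto (fun x : ℝ ↦ normCount (fun a : {a // ¬ p a} ↦ ν a) x / x) atTop
      (𝓝 (c - c * (q : ℝ)⁻¹)) := by
  classical
  have hq0 : (0 : ℝ) < q := by exact_mod_cast hq
  have hcount : ∀ x : ℝ, (normCount ν x : ℝ) =
      normCount ν (x / q) + normCount (fun a : {a // ¬ p a} ↦ ν a) x := by
    intro x
    have h1 : normCount (fun a : {a // p a} ↦ ν a) x = normCount ν (x / q) := by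
      refine (Nat.card_congr (e.subtypeEquiv fun a ↦ ?_)).symm
      change _ ↔ (ν (e a).1 : ℝ) ≤ x
      rw [he, le_div_iff₀' hq0]
      push_cast
      rfl
    have hf1 : Finite {a : {a // p a} // (ν a : ℝ) ≤ x} :=
      (hνf x).preimage Subtype.val_injective.injOn
    have hf2 : Finite {a : {a // ¬ p a} // (ν a : ℝ) ≤ x} :=
      (hνf x).preimage Subtype.val_injective.injOn
    have h2 : normCount ν x = normCount (fun a : {a // p a} ↦ ν a) x +
        normCount (fun a : {a // ¬ p a} ↦ ν a) x := by
      rw [normCount, normCount, normCount, ← Nat.card_sum]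
      refine Nat.card_congr (((Equiv.sumCompl p).symm.subtypeEquiv
        (q := Sum.elim (fun a ↦ (ν a.1 : ℝ) ≤ x) fun a ↦ (ν a.1 : ℝ) ≤ x) fun a ↦ ?_).trans
          Equiv.subtypeSum)
      by_cases ha : p a
      · rw [Equiv.sumCompl_symm_apply_of_pos ha]; rfl
      · rw [Equiv.sumCompl_symm_apply_of_neg ha]; rfl
    rw [h2, h1]
    push_cast
    ring
  have h1 : Tendsto (fun x : ℝ ↦ x / q) atTop atTop := tendsto_id.atTop_div_const hq0
  refine (h.sub ((h.comp h1).mul_const (q : ℝ)⁻¹)).congr' ?_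
  filter_upwards [eventually_gt_atTop 0] with x hx
  rw [hcount x]
  simp only [Function.comp_apply]
  field_simp
  ring

end NormCountProduct

/-! ### Zeta poles, negligible factors and their products. -/

section ZetaPole

open Filter Topology

/-- A set with a norm `ν` whose zeta function `∑ ν(a) ^ (-s)` converges for `Re s > 1` and continues to
`Re s > 0` with a pole of order `j + 1` at `s = 1`, and whose number of elements of norm at most `x`
is asymptotic to a multiple of `x log(x) ^ j`. -/
structure HasZetaPole {X : Type*} (ν : X → ℕ) (j : ℕ) : Prop where
  pos : ∀ a, 0 < ν a
  summable : ∀ s : ℂ, 1 < s.re → Summable fun a ↦ (ν a : ℂ) ^ (-s)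
  continuation : ∃ F : ℂ → ℂ, MeromorphicOn F {s : ℂ | 0 < s.re} ∧
    (∀ s : ℂ, 1 < s.re → F s = ∑' a, (ν a : ℂ) ^ (-s)) ∧
    meromorphicOrderAt F 1 = ((-((j + 1 : ℕ) : ℤ) : ℤ) : WithTop ℤ)
  asymptotic : ∃ c : ℝ, 0 < c ∧
    Tendsto (fun x : ℝ ↦ normCount ν x / (x * Real.log x ^ j)) atTop (𝓝 c)

/-- A set with a norm `β` such that `∑ β(b) ^ (-σ)` converges for all `σ > 0`. -/
structure IsNormNegligible {B : Type*} (β : B → ℕ) : Prop where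
  pos : ∀ b, 0 < β b
  summable : ∀ σ : ℝ, 0 < σ → Summable fun b ↦ (β b : ℝ) ^ (-σ)

variable {X Y B : Type*} {ν : X → ℕ} {μ : Y → ℕ} {β : B → ℕ}

theorem norm_natCast_cpow_neg {n : ℕ} (hn : 0 < n) (s : ℂ) :
    ‖(n : ℂ) ^ (-s)‖ = (n : ℝ) ^ (-s.re) := by
  rw [Complex.norm_natCast_cpow_of_pos hn, Complex.neg_re]

theorem finite_norm_le_of_summable (hν : ∀ a, 0 < ν a) {σ : ℝ} (hσ : 0 < σ)
    (h : Summable fun a ↦ (ν a : ℝ) ^ (-σ)) (x : ℝ) : {a | (ν a : ℝ) ≤ x}.Finite := by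
  rcases le_or_gt x 0 with hx | hx
  · convert Set.finite_empty
    ext a
    have : (0 : ℝ) < ν a := by exact_mod_cast hν a
    simpa using hx.trans_lt this
  have hlt : 0 < x ^ (-σ) := by positivity
  have := h.tendsto_cofinite_zero.eventually_lt_const hlt
  rw [Filter.eventually_cofinite] at this
  refine this.subset fun a ha ↦ ?_
  have h1 : (0 : ℝ) < ν a := by exact_mod_cast hν a
  simp only [Set.mem_ofPred_eq, not_lt] at ha ⊢
  exact Real.rpow_le_rpow_of_nonpos h1 ha (by linarith)

theorem HasZetaPole.finite {j : ℕ} (h : HasZetaPole ν j) (x : ℝ) : {a | (ν a : ℝ) ≤ x}.Finite := by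
  refine finite_norm_le_of_summable h.pos (σ := 2) two_pos ?_ x
  refine (h.summable 2 (by norm_num)).norm.congr fun a ↦ ?_
  rw [norm_natCast_cpow_neg (h.pos a)]
  simp

theorem IsNormNegligible.finite (h : IsNormNegligible β) (x : ℝ) : {b | (β b : ℝ) ≤ x}.Finite :=
  finite_norm_le_of_summable h.pos one_pos (h.summable 1 one_pos) x

theorem HasZetaPole.of_equiv {j : ℕ} (h : HasZetaPole ν j) (e : X ≃ Y)
    (he : ∀ a, μ (e a) = ν a) : HasZetaPole μ j where
  pos b := by rw [← e.apply_symm_apply b, he]; exact h.pos _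
  summable s hs := by
    rw [← e.summable_iff]
    simpa only [Function.comp_def, he] using h.summable s hs
  continuation := by
    obtain ⟨F, hF, hFs, hF1⟩ := h.continuation
    refine ⟨F, hF, fun s hs ↦ ?_, hF1⟩
    rw [hFs s hs, ← e.tsum_eq]
    simp only [he]
  asymptotic := by
    simpa only [normCount_equiv e he] using h.asymptotic

theorem IsNormNegligible.of_injective {C : Type*} {γ : C → ℕ} (h : IsNormNegligible β) {f : C → B}
    (hf : Function.Injective f) (hγ : ∀ c, 0 < γ c) {m : ℕ} (hm : 0 < m)
    (hle : ∀ c, β (f c) ≤ m * γ c) : IsNormNegligible γ where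
  pos := hγ
  summable σ hσ := by
    refine .of_nonneg_of_le (fun c ↦ by positivity) (fun c ↦ ?_)
      (((h.summable σ hσ).comp_injective hf).mul_left ((m : ℝ) ^ σ))
    have h1 : (0 : ℝ) < γ c := by exact_mod_cast hγ c
    have h2 : (0 : ℝ) < β (f c) := by exact_mod_cast h.pos _
    have hm0 : (0 : ℝ) < m := by exact_mod_cast hm
    have h3 : (β (f c) : ℝ) ≤ m * γ c := by exact_mod_cast hle c
    have h4 := Real.rpow_le_rpow_of_nonpos h2 h3 (by linarith : -σ ≤ 0)
    rw [Real.mul_rpow hm0.le h1.le, Real.rpow_neg hm0.le, inv_mul_le_iff₀ (by positivity)] at h4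
    exact h4

theorem IsNormNegligible.prod {C : Type*} {γ : C → ℕ} (hβ : IsNormNegligible β)
    (hγ : IsNormNegligible γ) : IsNormNegligible fun p : B × C ↦ β p.1 * γ p.2 where
  pos p := Nat.mul_pos (hβ.pos _) (hγ.pos _)
  summable σ hσ := by
    refine ((hβ.summable σ hσ).mul_of_nonneg (hγ.summable σ hσ) (fun _ ↦ by positivity)
      fun _ ↦ by positivity).congr fun p ↦ ?_
    push_cast
    rw [Real.mul_rpow (by positivity) (by positivity)]

theorem IsNormNegligible.of_equiv {C : Type*} {γ : C → ℕ} (h : IsNormNegligible β) (e : B ≃ C)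
    (he : ∀ a, γ (e a) = β a) : IsNormNegligible γ :=
  h.of_injective e.symm.injective (fun c ↦ by rw [← e.apply_symm_apply c, he]; exact h.pos _)
    one_pos fun c ↦ by rw [one_mul, ← he, e.apply_symm_apply]

theorem IsNormNegligible.pi {n : ℕ} {B : Fin n → Type} {β : ∀ i, B i → ℕ}
    (h : ∀ i, IsNormNegligible (β i)) :
    IsNormNegligible fun b : ∀ i, B i ↦ ∏ i, β i (b i) := by
  induction n with
  | zero => exact ⟨fun b ↦ by simp, fun σ _ ↦ .of_finite⟩
  | succ n ih =>
    exact ((h 0).prod (ih fun i ↦ h i.succ)).of_equiv (Fin.consEquiv B) fun p ↦ by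
      simp [Fin.prod_univ_succ, Fin.consEquiv]

theorem meromorphicOrderAt_eq_zero_of_differentiableOn {f : ℂ → ℂ}
    (hf : DifferentiableOn ℂ f {s : ℂ | 0 < s.re}) (h1 : f 1 ≠ 0) : meromorphicOrderAt f 1 = 0 := by
  have hopen : IsOpen {s : ℂ | 0 < s.re} := isOpen_lt continuous_const Complex.continuous_re
  have hmem : {s : ℂ | 0 < s.re} ∈ 𝓝 (1 : ℂ) := hopen.mem_nhds (by simp)
  have han := hf.analyticAt hmem
  rw [← tendsto_ne_zero_iff_meromorphicOrderAt_eq_zero han.meromorphicAt]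
  exact ⟨f 1, h1, han.continuousAt.tendsto.mono_left nhdsWithin_le_nhds⟩

theorem IsNormNegligible.summable_cpow (h : IsNormNegligible β) {s : ℂ} (hs : 0 < s.re) :
    Summable fun b ↦ (β b : ℂ) ^ (-s) :=
  .of_norm ((h.summable s.re hs).congr fun b ↦ by rw [norm_natCast_cpow_neg (h.pos b)])

theorem IsNormNegligible.differentiableOn (h : IsNormNegligible β) :
    DifferentiableOn ℂ (fun s ↦ ∑' b, (β b : ℂ) ^ (-s)) {s : ℂ | 0 < s.re} := by
  have hopen : IsOpen {s : ℂ | 0 < s.re} := isOpen_lt continuous_const Complex.continuous_re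
  refine (SummableLocallyUniformlyOn_of_locally_bounded hopen fun K hK hKc ↦ ?_).differentiableOn
    hopen fun b s _ ↦ ?_
  · rcases K.eq_empty_or_nonempty with rfl | hne
    · exact ⟨0, summable_zero, by simp⟩
    obtain ⟨s₀, hs₀, hmin⟩ := hKc.exists_isMinOn hne Complex.continuous_re.continuousOn
    refine ⟨fun b ↦ (β b : ℝ) ^ (-s₀.re), h.summable _ (hK hs₀), fun b s hs ↦ ?_⟩
    rw [norm_natCast_cpow_neg (h.pos b)]
    exact Real.rpow_le_rpow_of_exponent_le (by exact_mod_cast h.pos b) (neg_le_neg (hmin hs))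
  · have : (β b : ℂ) ≠ 0 := by exact_mod_cast (h.pos b).ne'
    fun_prop (disch := simp [(h.pos b).ne'])

theorem IsNormNegligible.tsum_one_ne_zero [Nonempty B] (h : IsNormNegligible β) :
    ∑' b, (β b : ℂ) ^ (-(1 : ℂ)) ≠ 0 := by
  have h1 : ∑' b, (β b : ℂ) ^ (-(1 : ℂ)) = ((∑' b, (β b : ℝ) ^ (-(1 : ℝ)) : ℝ) : ℂ) := by
    rw [Complex.ofReal_tsum]
    refine tsum_congr fun b ↦ ?_
    rw [Complex.ofReal_cpow (by positivity)]
    simp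
  rw [h1]
  obtain ⟨b⟩ := ‹Nonempty B›
  have : (0 : ℝ) < β b := by exact_mod_cast h.pos b
  exact_mod_cast ((h.summable 1 one_pos).tsum_pos (fun _ ↦ by positivity) b (by positivity)).ne'

/-- The negligible zeta function is holomorphic on `Re s > 0`, and at `1` it is a sum of positive
terms, nonempty by assumption. So it cannot alter the pole order. -/
theorem HasZetaPole.prod_negligible [Nonempty B] {j : ℕ} (hν : HasZetaPole ν j)
    (hβ : IsNormNegligible β) : HasZetaPole (fun p : X × B ↦ ν p.1 * β p.2) j where
  pos p := Nat.mul_pos (hν.pos _) (hβ.pos _)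
  summable s hs := by
    refine (summable_mul_of_summable_norm (hν.summable s hs).norm
      (hβ.summable_cpow (by linarith)).norm).congr fun p ↦ ?_
    rw [Nat.cast_mul, Complex.natCast_mul_natCast_cpow]
  continuation := by
    obtain ⟨F, hF, hFs, hF1⟩ := hν.continuation
    have hopen : IsOpen {s : ℂ | 0 < s.re} := isOpen_lt continuous_const Complex.continuous_re
    have hmer : ∀ s : ℂ, 0 < s.re → MeromorphicAt (fun s ↦ ∑' b, (β b : ℂ) ^ (-s)) s :=
      fun s hs ↦ (hβ.differentiableOn.analyticAt (hopen.mem_nhds hs)).meromorphicAt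
    refine ⟨F * fun s ↦ ∑' b, (β b : ℂ) ^ (-s), fun s hs ↦ (hF s hs).mul (hmer s hs),
      fun s hs ↦ ?_, ?_⟩
    · rw [Pi.mul_apply, hFs s hs, tsum_mul_tsum_of_summable_norm (hν.summable s hs).norm
        (hβ.summable_cpow (by linarith)).norm]
      refine tsum_congr fun p ↦ ?_
      rw [Nat.cast_mul, Complex.natCast_mul_natCast_cpow]
    · rw [meromorphicOrderAt_mul (hF 1 (by simp)) (hmer 1 (by simp)), hF1,
        meromorphicOrderAt_eq_zero_of_differentiableOn hβ.differentiableOn hβ.tsum_one_ne_zero,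
        add_zero]
  asymptotic := by
    obtain ⟨c, hc, h⟩ := hν.asymptotic
    have hs : Summable fun b ↦ (β b : ℝ)⁻¹ := by
      simpa only [Real.rpow_neg_one] using hβ.summable 1 one_pos
    obtain ⟨b⟩ := ‹Nonempty B›
    refine ⟨_, ?_, tendsto_normCount_prod_of_summable hν.pos hβ.pos hν.finite hβ.finite hs h⟩
    have : (0 : ℝ) < β b := by exact_mod_cast hβ.pos b
    exact (hs.mul_left c).tsum_pos (fun _ ↦ by positivity) b (by positivity)

/-- Zeta functions multiply and pole orders add; since the index `j` stands for order `j + 1`, the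
indices `j` and `0` give `j + 1`. -/
theorem HasZetaPole.prod {j : ℕ} (hν : HasZetaPole ν j) (hμ : HasZetaPole μ 0) :
    HasZetaPole (fun p : X × Y ↦ ν p.1 * μ p.2) (j + 1) where
  pos p := Nat.mul_pos (hν.pos _) (hμ.pos _)
  summable s hs := by
    refine (summable_mul_of_summable_norm (hν.summable s hs).norm
      (hμ.summable s hs).norm).congr fun p ↦ ?_
    rw [Nat.cast_mul, Complex.natCast_mul_natCast_cpow]
  continuation := by
    obtain ⟨F, hF, hFs, hF1⟩ := hν.continuation
    obtain ⟨G, hG, hGs, hG1⟩ := hμ.continuation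
    refine ⟨F * G, fun s hs ↦ (hF s hs).mul (hG s hs), fun s hs ↦ ?_, ?_⟩
    · rw [Pi.mul_apply, hFs s hs, hGs s hs, tsum_mul_tsum_of_summable_norm (hν.summable s hs).norm
        (hμ.summable s hs).norm]
      refine tsum_congr fun p ↦ ?_
      rw [Nat.cast_mul, Complex.natCast_mul_natCast_cpow]
    · rw [meromorphicOrderAt_mul (hF 1 (by simp)) (hG 1 (by simp)), hF1, hG1, ← WithTop.coe_add]
      congr 1
  asymptotic := by
    obtain ⟨c, hc, h⟩ := hν.asymptotic
    obtain ⟨c', hc', h'⟩ := hμ.asymptotic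
    exact ⟨c' * (c * (1 / (j + 1))), by positivity, tendsto_normCount_prod hν.pos hμ.pos hν.finite hμ.finite h
      (by simpa using h')⟩

theorem HasZetaPole.pi {n : ℕ} {X : Fin (n + 1) → Type} {ν : ∀ i, X i → ℕ}
    (h : ∀ i, HasZetaPole (ν i) 0) : HasZetaPole (fun a : ∀ i, X i ↦ ∏ i, ν i (a i)) n := by
  induction n with
  | zero =>
    have : Unique (Fin (0 + 1)) := inferInstanceAs (Unique (Fin 1))
    exact (h _).of_equiv (Equiv.piUnique X).symm fun a ↦ Fintype.prod_unique _
  | succ n ih =>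
    exact ((ih fun i ↦ h i.succ).prod (h 0)).of_equiv
      ((Equiv.prodComm _ _).trans (Fin.consEquiv X)) fun p ↦ by
        simp [Fin.prod_univ_succ, Fin.consEquiv, mul_comm]

/-- Removing a copy of `X` in which norms are multiplied by `q`. -/
theorem HasZetaPole.subtype (hν : HasZetaPole ν 0) {p : X → Prop} {q : ℕ} (hq : 1 < q)
    (e : X ≃ {a // p a}) (he : ∀ a, ν (e a) = q * ν a) :
    HasZetaPole (fun a : {a // ¬ p a} ↦ ν a) 0 where
  pos a := hν.pos _
  summable s hs := (hν.summable s hs).subtype _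
  continuation := by
    obtain ⟨F, hF, hFs, hF1⟩ := hν.continuation
    have hq0 : (q : ℂ) ≠ 0 := by exact_mod_cast (by lia : q ≠ 0)
    -- Removing the copy multiplies the zeta function by `1 - q^(-s)`, which is entire and nonzero
    -- at `1` because `q > 1`.
    have hdiff : Differentiable ℂ fun s : ℂ ↦ 1 - (q : ℂ) ^ (-s) := by
      fun_prop (disch := simp [hq0])
    have hmer : ∀ s, MeromorphicAt (fun s : ℂ ↦ 1 - (q : ℂ) ^ (-s)) s := fun s ↦
      (hdiff.analyticAt s).meromorphicAt
    refine ⟨F * fun s : ℂ ↦ 1 - (q : ℂ) ^ (-s), fun s hs ↦ (hF s hs).mul (hmer s), fun s hs ↦ ?_, ?_⟩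
    · have h1 : ∑' a : {a // p a}, (ν a : ℂ) ^ (-s) = (q : ℂ) ^ (-s) * ∑' a, (ν a : ℂ) ^ (-s) := by
        rw [← e.tsum_eq, ← tsum_mul_left]
        refine tsum_congr fun a ↦ ?_
        rw [he, Nat.cast_mul, Complex.natCast_mul_natCast_cpow]
      have h3 : ∑' a : {a // ¬ p a}, (ν a : ℂ) ^ (-s) = F s - (q : ℂ) ^ (-s) * F s := by
        rw [hFs s hs, ← h1, eq_sub_iff_add_eq',
          ← (hν.summable s hs).tsum_subtype_add_tsum_subtype_compl {a | p a}]
        rfl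
      rw [h3, Pi.mul_apply]
      ring
    · rw [meromorphicOrderAt_mul (hF 1 (by simp)) (hmer 1), hF1,
        meromorphicOrderAt_eq_zero_of_differentiableOn hdiff.differentiableOn, add_zero]
      rw [Complex.cpow_neg_one, sub_ne_zero, ne_comm, Ne, inv_eq_one]
      exact_mod_cast hq.ne'
  asymptotic := by
    obtain ⟨c, hc, h⟩ := hν.asymptotic
    simp only [pow_zero, mul_one] at h ⊢
    refine ⟨_, ?_, tendsto_normCount_subtype hν.finite (by lia) e he h⟩
    have : (q : ℝ)⁻¹ < 1 := inv_lt_one_of_one_lt₀ (by exact_mod_cast hq)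
    nlinarith

end ZetaPole

/-! ### The simple pole of the Dedekind zeta function. -/

section NumberFieldPole

open NumberField Filter Topology
open scoped nonZeroDivisors

variable (K : Type) [Field K] [NumberField K]

theorem dedekindZeta_eq_tsum_ideal {s : ℂ} (hs : 1 < s.re) :
    dedekindZeta K s = ∑' I : (Ideal (𝓞 K))⁰, (Ideal.absNorm (I : Ideal (𝓞 K)) : ℂ) ^ (-s) := by
  let N : (Ideal (𝓞 K))⁰ → ℕ := fun I ↦ Ideal.absNorm (I : Ideal (𝓞 K))
  have hsum := (Equiv.sigmaFiberEquiv N).summable_iff.2 (summable_absNorm_cpow (K := K) hs)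
  have hfib : ∀ n : ℕ, Finite {I : (Ideal (𝓞 K))⁰ // N I = n} := by
    intro n
    have := Ideal.finite_setOfPred_absNorm_eq (S := 𝓞 K) n
    exact this.preimage Subtype.val_injective.injOn
  rw [← (Equiv.sigmaFiberEquiv N).tsum_eq]
  simp only [Function.comp_def] at hsum
  rw [hsum.tsum_sigma' fun n ↦ .of_finite, dedekindZeta, LSeries]
  refine tsum_congr fun n ↦ ?_
  have h1 : ∀ I : {I : (Ideal (𝓞 K))⁰ // N I = n},
      ((Ideal.absNorm (Equiv.sigmaFiberEquiv N ⟨n, I⟩ : Ideal (𝓞 K)) : ℕ) : ℂ) ^ (-s) =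
        (n : ℂ) ^ (-s) := fun I ↦ by
    change (N I.1 : ℂ) ^ (-s) = _
    rw [I.2]
  rw [tsum_congr h1, tsum_const, nsmul_eq_mul]
  rcases Nat.eq_zero_or_pos n with rfl | hn
  · have : IsEmpty {I : (Ideal (𝓞 K))⁰ // N I = 0} :=
      ⟨fun I ↦ Ideal.absNorm_ne_zero_of_nonZeroDivisors I.1 I.2⟩
    simp
  · rw [LSeries.term_of_ne_zero hn.ne', Complex.cpow_neg, div_eq_mul_inv]
    congr 2
    refine Nat.card_congr ⟨fun I ↦ ⟨⟨I.1, mem_nonZeroDivisors_of_ne_zero ?_⟩, I.2⟩,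
      fun I ↦ ⟨I.1.1, I.2⟩, fun _ ↦ rfl, fun _ ↦ rfl⟩
    intro h0
    have := I.2
    rw [h0] at this
    simp at this
    lia

/-- For a meromorphic function a limit along the real axis from the right already decides the order:
a negative order of `(s - 1) F` would make it unbounded there, a positive one would make the limit
zero. -/
theorem meromorphicOrderAt_eq_neg_one {F : ℂ → ℂ} (hF : MeromorphicAt F 1) {ρ : ℂ} (hρ : ρ ≠ 0)
    (h : Tendsto (fun s : ℝ ↦ ((s : ℂ) - 1) * F s) (𝓝[>] 1) (𝓝 ρ)) :
    meromorphicOrderAt F 1 = ((-1 : ℤ) : WithTop ℤ) := by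
  have hid : MeromorphicAt (fun s : ℂ ↦ s - 1) 1 := by fun_prop
  have hmap : Tendsto (fun s : ℝ ↦ (s : ℂ)) (𝓝[>] 1) (𝓝[≠] 1) := by
    refine tendsto_nhdsWithin_iff.2 ⟨?_, ?_⟩
    · exact (Complex.continuous_ofReal.tendsto' 1 1 (by simp)).mono_left nhdsWithin_le_nhds
    · filter_upwards [self_mem_nhdsWithin] with s hs h1
      exact absurd (Complex.ofReal_eq_one.1 h1) (ne_of_gt hs)
  have hG : MeromorphicAt ((fun s : ℂ ↦ s - 1) * F) 1 := hid.mul hF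
  have h0 : meromorphicOrderAt ((fun s : ℂ ↦ s - 1) * F) 1 = 0 := by
    rcases lt_trichotomy (meromorphicOrderAt ((fun s : ℂ ↦ s - 1) * F) 1) 0 with h1 | h1 | h1
    · have h2 := ((tendsto_cobounded_iff_meromorphicOrderAt_neg hG).2 h1).comp hmap
      exact absurd (tendsto_norm_atTop_iff_cobounded.2 h2) (not_tendsto_atTop_of_tendsto_nhds h.norm)
    · exact h1
    · have h2 := ((tendsto_zero_iff_meromorphicOrderAt_pos hG).2 h1).comp hmap
      exact absurd (tendsto_nhds_unique h h2) hρ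
  rw [meromorphicOrderAt_mul hid hF] at h0
  have h1 : meromorphicOrderAt (fun s : ℂ ↦ s - 1) 1 = 1 := by
    simp
  rw [h1] at h0
  cases hm : meromorphicOrderAt F 1 with
  | top => simp [hm] at h0
  | coe n =>
    rw [hm] at h0
    have h2 : ((1 + n : ℤ) : WithTop ℤ) = ((0 : ℤ) : WithTop ℤ) := h0
    rw [WithTop.coe_inj] at h2
    congr 1
    lia

/-- The residue in the class number formula fixes the pole order of the continuation, and it is also
the density of ideals by norm. -/
theorem hasZetaPole_absNorm :
    HasZetaPole (fun I : (Ideal (𝓞 K))⁰ ↦ Ideal.absNorm (I : Ideal (𝓞 K))) 0 where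
  pos I := Ideal.absNorm_pos_of_nonZeroDivisors I
  summable s hs := summable_absNorm_cpow hs
  continuation := by
    obtain ⟨F, hF, hFs⟩ := exists_meromorphicOn_tsum_absNorm_cpow (K := K)
    refine ⟨F, hF, hFs, ?_⟩
    refine meromorphicOrderAt_eq_neg_one (hF 1 (by simp))
      (ρ := (dedekindZeta_residue K : ℂ)) (by exact_mod_cast dedekindZeta_residue_ne_zero K) ?_
    refine (tendsto_sub_one_mul_dedekindZeta_nhdsGT K).congr' ?_
    filter_upwards [self_mem_nhdsWithin] with s hs
    rw [hFs _ (by simpa using hs), dedekindZeta_eq_tsum_ideal K (by simpa using hs)]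
  asymptotic := by
    refine ⟨dedekindZeta_residue K, dedekindZeta_residue_pos K, ?_⟩
    simpa [normCount, dedekindZeta_residue_def] using Ideal.tendsto_norm_le_div_atTop₀ K

end NumberFieldPole

/-! ### Ideals supported at `m` and ideals coprime to `m`. -/

section IdealClasses

/-- The ideals of finite index that contain a power of `m`. -/
def smoothIdeals (R : Type*) [CommRing R] (m : ℕ) : Set (Ideal R) :=
  {I | Finite (R ⧸ I) ∧ ∃ k : ℕ, (m : R) ^ k ∈ I}

/-- The ideals of finite index that are coprime to `m`. -/
def coprimeIdeals (R : Type*) [CommRing R] (m : ℕ) : Set (Ideal R) :=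
  {I | Finite (R ⧸ I) ∧ ∃ a ∈ I, ∃ b : R, a + b * (m : R) = 1}

theorem idealIndex_pos {R : Type*} [CommRing R] {I : Ideal R} (h : Finite (R ⧸ I)) :
    0 < idealIndex I :=
  Nat.card_pos

end IdealClasses

/-! ### Both classes of ideals in a ring of integers. -/

section NumberFieldIdeals

open NumberField
open scoped nonZeroDivisors

variable (K : Type) [Field K] [NumberField K]

theorem idealIndex_eq_absNorm (I : Ideal (𝓞 K)) : idealIndex I = Ideal.absNorm I := rfl

variable {K} in
theorem one_lt_absNorm_of_prime {P : Ideal (𝓞 K)} (hP : Prime P) : 1 < Ideal.absNorm P := by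
  have h0 : Ideal.absNorm P ≠ 0 := by
    rw [Ne, Ideal.absNorm_eq_zero_iff]
    exact hP.ne_zero
  have h1 : Ideal.absNorm P ≠ 1 := by
    rw [Ne, Ideal.absNorm_eq_one_iff]
    exact fun h ↦ hP.not_isUnit (Ideal.isUnit_iff.2 h)
  lia

/-- Euler factors are removed one prime at a time: among the ideals avoiding `S`, those divisible by
a new prime `P` are `P` times such an ideal, a copy with norms multiplied by `N(P)`. -/
theorem hasZetaPole_not_dvd (S : Finset (Ideal (𝓞 K))) (hS : ∀ P ∈ S, Prime P) :
    HasZetaPole (fun I : {I : Ideal (𝓞 K) // I ≠ ⊥ ∧ ∀ P ∈ S, ¬ P ∣ I} ↦ idealIndex I.1) 0 := by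
  classical
  induction S using Finset.induction_on with
  | empty =>
    exact (hasZetaPole_absNorm K).of_equiv
      (Equiv.subtypeEquivRight fun I ↦ by simp [mem_nonZeroDivisors_iff_ne_zero]) fun I ↦ rfl
  | insert P S hPS ih =>
    have hP : Prime P := hS P (S.mem_insert_self P)
    specialize ih fun Q hQ ↦ hS Q (Finset.mem_insert_of_mem hQ)
    let g : {I : Ideal (𝓞 K) // I ≠ ⊥ ∧ ∀ P ∈ S, ¬ P ∣ I} →
        {a : {I : Ideal (𝓞 K) // I ≠ ⊥ ∧ ∀ P ∈ S, ¬ P ∣ I} // P ∣ a.1} := fun I ↦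
      ⟨⟨P * I.1, mul_ne_zero hP.ne_zero I.2.1, fun Q hQ h ↦ by
        rcases (hS Q (Finset.mem_insert_of_mem hQ)).dvd_or_dvd h with h | h
        · exact hPS ((associated_iff_eq.1
            ((hS Q (Finset.mem_insert_of_mem hQ)).associated_of_dvd hP h)) ▸ hQ)
        · exact I.2.2 Q hQ h⟩, dvd_mul_right _ _⟩
    have hg : Function.Bijective g := by
      constructor
      · intro I J h
        exact Subtype.ext (mul_left_cancel₀ hP.ne_zero
          (congrArg (fun a ↦ a.1.1) h : P * I.1 = P * J.1))
      · rintro ⟨⟨J, hJ0, hJ⟩, hPJ⟩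
        obtain ⟨I, rfl⟩ : P ∣ J := hPJ
        exact ⟨⟨I, right_ne_zero_of_mul hJ0, fun Q hQ h ↦ hJ Q hQ (h.mul_left P)⟩, rfl⟩
    have hq := one_lt_absNorm_of_prime hP
    refine (ih.subtype hq (Equiv.ofBijective g hg) fun I ↦ ?_).of_equiv
      ⟨fun I ↦ ⟨I.1.1, I.1.2.1, fun Q hQ ↦ ?_⟩,
        fun I ↦ ⟨⟨I.1, I.2.1, fun Q hQ ↦ I.2.2 Q (Finset.mem_insert_of_mem hQ)⟩,
          I.2.2 P (S.mem_insert_self P)⟩, fun _ ↦ rfl, fun _ ↦ rfl⟩ fun _ ↦ rfl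
    · exact map_mul Ideal.absNorm P I.1
    · rcases Finset.mem_insert.1 hQ with rfl | hQ
      · exact I.2
      · exact I.1.2.2 Q hQ

/-- The primes over `m` in the ring of integers of `K`. -/
noncomputable def primesDividing (m : ℕ) : Finset (Ideal (𝓞 K)) :=
  open Classical in
  (UniqueFactorizationMonoid.normalizedFactors (Ideal.span {(m : 𝓞 K)})).toFinset

variable {K} {m : ℕ}

theorem span_natCast_ne_bot (hm : m ≠ 0) : Ideal.span {(m : 𝓞 K)} ≠ ⊥ := by
  simpa using hm

theorem mem_primesDividing (hm : m ≠ 0) {P : Ideal (𝓞 K)} :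
    P ∈ primesDividing K m ↔ Prime P ∧ (m : 𝓞 K) ∈ P := by
  classical
  rw [primesDividing, Multiset.mem_toFinset,
    UniqueFactorizationMonoid.mem_normalizedFactors_iff' (span_natCast_ne_bot hm)]
  rw [Ideal.dvd_span_singleton]
  simp [UniqueFactorizationMonoid.irreducible_iff_prime]

theorem mem_coprimeIdeals_iff (hm : m ≠ 0) {I : Ideal (𝓞 K)} :
    I ∈ coprimeIdeals (𝓞 K) m ↔ I ≠ ⊥ ∧ ∀ P ∈ primesDividing K m, ¬ P ∣ I := by
  have hfin : Finite (𝓞 K ⧸ I) ↔ I ≠ ⊥ := by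
    rw [← Ideal.absNorm_ne_zero_iff, Ne, Ideal.absNorm_eq_zero_iff]
  rw [coprimeIdeals, Set.mem_ofPred_eq, hfin]
  refine and_congr_right fun hI ↦ ?_
  have hsup : (∃ a ∈ I, ∃ b : 𝓞 K, a + b * (m : 𝓞 K) = 1) ↔ I ⊔ Ideal.span {(m : 𝓞 K)} = ⊤ := by
    rw [Ideal.eq_top_iff_one, Submodule.mem_sup]
    simp only [Ideal.mem_span_singleton']
    exact ⟨fun ⟨a, ha, b, h⟩ ↦ ⟨a, ha, _, ⟨b, rfl⟩, h⟩, fun ⟨a, ha, _, ⟨b, rfl⟩, h⟩ ↦ ⟨a, ha, b, h⟩⟩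
  rw [hsup]
  constructor
  · intro h P hP hPI
    rw [mem_primesDividing hm] at hP
    refine hP.1.not_isUnit (Ideal.isUnit_iff.2 (top_le_iff.1 (h ▸ sup_le ?_ ?_)))
    · exact Ideal.le_of_dvd hPI
    · exact (Ideal.span_singleton_le_iff_mem _).2 hP.2
  · intro h
    by_contra htop
    obtain ⟨P, hP, hle⟩ := Ideal.exists_le_maximal _ htop
    have hIP : I ≤ P := le_sup_left.trans hle
    have hP0 : P ≠ ⊥ := fun h0 ↦ hI (le_bot_iff.1 (h0 ▸ hIP))
    refine h P ((mem_primesDividing hm).2 ⟨Ideal.prime_of_isPrime hP0 hP.isPrime, ?_⟩)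
      (Ideal.dvd_iff_le.2 hIP)
    exact (Ideal.span_singleton_le_iff_mem _).1 (le_sup_right.trans hle)

variable (K) in
theorem hasZetaPole_coprimeIdeals (hm : m ≠ 0) :
    HasZetaPole (fun I : coprimeIdeals (𝓞 K) m ↦ idealIndex I.1) 0 :=
  (hasZetaPole_not_dvd K (primesDividing K m) fun _ hP ↦ ((mem_primesDividing hm).1 hP).1).of_equiv
    (Equiv.subtypeEquivRight fun _ ↦ (mem_coprimeIdeals_iff hm).symm) fun _ ↦ rfl

theorem isNormNegligible_two_pow : IsNormNegligible fun e : ℕ ↦ 2 ^ e where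
  pos e := by positivity
  summable σ hσ := by
    refine (summable_geometric_of_lt_one (r := (2 : ℝ) ^ (-σ)) (by positivity)
      (Real.rpow_lt_one_of_one_lt_of_neg one_lt_two (by linarith))).congr fun e ↦ ?_
    push_cast
    rw [← Real.rpow_natCast, ← Real.rpow_mul two_pos.le, ← Real.rpow_natCast,
      ← Real.rpow_mul two_pos.le, mul_comm]

variable (K) in
-- Such an ideal is determined by its exponents at the finitely many primes over `m`. Each of these
-- has norm at least `2`, so a product of geometric series dominates.
theorem isNormNegligible_smoothIdeals (hm : m ≠ 0) :
    IsNormNegligible fun I : smoothIdeals (𝓞 K) m ↦ idealIndex I.1 := by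
  classical
  let S := primesDividing K m
  let e := Fintype.equivFin S
  let F : smoothIdeals (𝓞 K) m → (Fin (Fintype.card S) → ℕ) := fun I i ↦
    (UniqueFactorizationMonoid.normalizedFactors I.1).count (e.symm i).1
  have hprod : ∀ I : smoothIdeals (𝓞 K) m, I.1 = ∏ i, (e.symm i).1 ^ F I i := by
    rintro ⟨I, hfin, k, hk⟩
    have hI : I ≠ ⊥ := by
      rwa [← Ideal.absNorm_ne_zero_iff, Ne, Ideal.absNorm_eq_zero_iff] at hfin
    have hsub : (UniqueFactorizationMonoid.normalizedFactors I).toFinset ⊆ S := fun P hP ↦ by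
      rw [Multiset.mem_toFinset, Ideal.mem_normalizedFactors_iff hI] at hP
      have h0 : P ≠ ⊥ := fun h0 ↦ hI (le_bot_iff.1 (h0 ▸ hP.2))
      exact (mem_primesDividing hm).2 ⟨Ideal.prime_of_isPrime h0 hP.1,
        hP.1.mem_of_pow_mem k (hP.2 hk)⟩
    have h1 := Ideal.prod_normalizedFactors_eq_self hI
    rw [Finset.prod_multiset_count_of_subset _ _ hsub, ← Finset.prod_coe_sort] at h1
    exact h1.symm.trans (e.symm.prod_comp fun P : S ↦
      P.1 ^ (UniqueFactorizationMonoid.normalizedFactors I).count P.1).symm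
  refine (IsNormNegligible.pi fun _ ↦ isNormNegligible_two_pow).of_injective (f := F)
    (fun I J h ↦ Subtype.ext ?_) (fun I ↦ idealIndex_pos I.2.1) one_pos fun I ↦ ?_
  · rw [hprod I, hprod J, h]
  · rw [one_mul, idealIndex_eq_absNorm]
    conv_rhs => rw [hprod I, map_prod]
    refine Finset.prod_le_prod' fun i _ ↦ ?_
    rw [map_pow]
    refine Nat.pow_le_pow_left ?_ _
    exact one_lt_absNorm_of_prime ((mem_primesDividing hm).1 (e.symm i).2).1

end NumberFieldIdeals

/-! ### Splitting an ideal into its part at `m` and its part away from `m`. -/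

section SmoothCoprimeSplitting

variable {R : Type*} [CommRing R]

theorem exists_eq_mul_dvd_pow_coprime (m n : ℕ) (hn : n ≠ 0) :
    ∃ a b k : ℕ, n = a * b ∧ a ∣ m ^ k ∧ b.Coprime m := by
  induction n using induction_on_primes with
  | zero => exact absurd rfl hn
  | one => exact ⟨1, 1, 0, rfl, one_dvd _, Nat.coprime_one_left m⟩
  | prime_mul p n hp ih =>
    obtain ⟨a, b, k, rfl, ha, hb⟩ := ih (right_ne_zero_of_mul hn)
    by_cases hpm : p ∣ m
    · exact ⟨p * a, b, k + 1, (mul_assoc _ _ _).symm, pow_succ' m k ▸ mul_dvd_mul hpm ha, hb⟩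
    · exact ⟨a, p * b, k, mul_left_comm _ _ _, ha,
        Nat.Coprime.mul_left ((Nat.Prime.coprime_iff_not_dvd hp).2 hpm) hb⟩

theorem natCast_idealIndex_mem (I : Ideal R) : (idealIndex I : R) ∈ I := by
  rw [← Ideal.Quotient.eq_zero_iff_mem, map_natCast, ← nsmul_one, idealIndex]
  exact card_nsmul_eq_zero'

theorem finite_quotient_of_le {I J : Ideal R} (h : I ≤ J) (hI : Finite (R ⧸ I)) :
    Finite (R ⧸ J) :=
  .of_surjective _ (Ideal.Quotient.factor_surjective h)

theorem isCoprime_of_mem_smoothIdeals {m : ℕ} {I J : Ideal R} (hI : I ∈ smoothIdeals R m)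
    (hJ : J ∈ coprimeIdeals R m) : IsCoprime I J := by
  obtain ⟨_, k, hk⟩ := hI
  obtain ⟨_, a, ha, b, hab⟩ := hJ
  have h1 : IsCoprime a ((m : R) ^ k) := .pow_right ⟨1, b, by rw [one_mul, hab]⟩
  obtain ⟨u, v, huv⟩ := h1
  rw [Ideal.isCoprime_iff_exists]
  exact ⟨v * (m : R) ^ k, I.mul_mem_left _ hk, u * a, J.mul_mem_left _ ha, by rw [add_comm, huv]⟩

theorem idealIndex_inf {I J : Ideal R} (h : IsCoprime I J) :
    idealIndex (I ⊓ J) = idealIndex I * idealIndex J := by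
  rw [idealIndex, Nat.card_congr (Ideal.quotientInfEquivQuotientProd I J h).toEquiv, Nat.card_prod]
  rfl

theorem le_of_inf_le_of_isCoprime {I J I' : Ideal R} (h : I ⊓ J ≤ I') (hc : IsCoprime I' J) :
    I ≤ I' := by
  obtain ⟨a, ha, b, hb, hab⟩ := Ideal.isCoprime_iff_exists.1 hc
  intro x hx
  rw [← one_mul x, ← hab, add_mul]
  exact I'.add_mem (I'.mul_mem_right _ ha) (h ⟨I.mul_mem_left _ hx, J.mul_mem_right _ hb⟩)

variable (R) in
/-- An ideal of finite index is uniquely the intersection of an ideal containing a power of `m` and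
an ideal coprime to `m`. -/
noncomputable def smoothCoprimeEquiv (m : ℕ) :
    smoothIdeals R m × coprimeIdeals R m ≃ FiniteIndexIdeal R :=
  Equiv.ofBijective (fun p ↦ ⟨p.1.1 ⊓ p.2.1, by
    have h := isCoprime_of_mem_smoothIdeals p.1.2 p.2.2
    have := p.1.2.1
    have := p.2.2.1
    exact .of_equiv _ (Ideal.quotientInfEquivQuotientProd _ _ h).symm.toEquiv⟩) (by
  constructor
  · rintro ⟨⟨I, hI⟩, ⟨J, hJ⟩⟩ ⟨⟨I', hI'⟩, ⟨J', hJ'⟩⟩ h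
    have h : I ⊓ J = I' ⊓ J' := congrArg Subtype.val h
    have hc := fun {A B} hA hB ↦ isCoprime_of_mem_smoothIdeals (R := R) (m := m) (I := A) (J := B) hA hB
    have h1 : I = I' := le_antisymm (le_of_inf_le_of_isCoprime (h.le.trans inf_le_left) (hc hI' hJ))
      (le_of_inf_le_of_isCoprime (h.ge.trans inf_le_left) (hc hI hJ'))
    have h2 : J = J' := le_antisymm
      (le_of_inf_le_of_isCoprime (inf_comm J I ▸ h.le.trans inf_le_right) (hc hI hJ').symm)
      (le_of_inf_le_of_isCoprime (inf_comm J' I' ▸ h.ge.trans inf_le_right) (hc hI' hJ).symm)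
    subst h1 h2
    rfl
  · rintro ⟨I, hI⟩
    -- The index of `I` lies in `I`. Writing it as `a b` with `a` dividing a power of `m` and `b`
    -- prime to `m`, the two components are `I + (a)` and `I + (b)`; their intersection is their
    -- product, which lies in `I` because `a b ∈ I`.
    obtain ⟨a, b, k, hn, ha, hb⟩ := exists_eq_mul_dvd_pow_coprime m _ (idealIndex_pos hI).ne'
    have hmem := natCast_idealIndex_mem I
    rw [hn, Nat.cast_mul] at hmem
    have h1 : I ⊔ Ideal.span {(a : R)} ∈ smoothIdeals R m := by
      refine ⟨finite_quotient_of_le le_sup_left hI, k, Ideal.mem_sup_right ?_⟩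
      rw [Ideal.mem_span_singleton]
      exact_mod_cast Nat.cast_dvd_cast (α := R) ha
    have h2 : I ⊔ Ideal.span {(b : R)} ∈ coprimeIdeals R m := by
      refine ⟨finite_quotient_of_le le_sup_left hI, ?_⟩
      obtain ⟨u, v, huv⟩ := (Nat.isCoprime_iff_coprime.2 hb).intCast (R := R)
      exact ⟨_, Ideal.mem_sup_right (Ideal.mul_mem_left _ (u : R) (Ideal.mem_span_singleton_self _)),
        v, by exact_mod_cast huv⟩
    refine ⟨⟨⟨_, h1⟩, ⟨_, h2⟩⟩, Subtype.ext (le_antisymm ?_ (le_inf le_sup_left le_sup_left))⟩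
    refine (Ideal.mul_eq_inf_of_isCoprime (isCoprime_of_mem_smoothIdeals h1 h2)).ge.trans ?_
    rw [Ideal.sup_mul, Ideal.mul_sup, Ideal.mul_sup, Ideal.span_singleton_mul_span_singleton]
    exact sup_le (sup_le Ideal.mul_le_right Ideal.mul_le_left) (sup_le Ideal.mul_le_right
      ((Ideal.span_singleton_le_iff_mem _).2 hmem)))

theorem idealIndex_smoothCoprimeEquiv (m : ℕ) (p : smoothIdeals R m × coprimeIdeals R m) :
    idealIndex (smoothCoprimeEquiv R m p).1 = idealIndex p.1.1 * idealIndex p.2.1 :=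
  idealIndex_inf (isCoprime_of_mem_smoothIdeals p.1.2 p.2.2)

end SmoothCoprimeSplitting

/-! ### Comparing ideals of `R` with those of an overring `O` satisfying `m O ⊆ R`. -/

section OrderTransfer

variable {R O : Type*} [CommRing R] [CommRing O] {φ : R →+* O} {m : ℕ}

/-- Multiplication by `m` carries the `O`-coefficients of an element of `IO` into `R`, so `m · IO ⊆
I`. -/
theorem exists_mem_map_eq_natCast_mul (hm : ∀ o, ∃ r, φ r = m * o) {I : Ideal R} {j : O}
    (hj : j ∈ I.map φ) : ∃ i ∈ I, φ i = m * j := by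
  suffices ∀ c : O, ∃ i ∈ I, φ i = m * (c * j) by simpa using this 1
  refine Submodule.span_induction ?_ ?_ ?_ ?_ hj
  · rintro _ ⟨x, hx, rfl⟩ c
    obtain ⟨r, hr⟩ := hm c
    exact ⟨r * x, I.mul_mem_left r hx, by rw [map_mul, hr, mul_assoc]⟩
  · exact fun c ↦ ⟨0, I.zero_mem, by simp⟩
  · intro x y _ _ hx hy c
    obtain ⟨i, hi, hi'⟩ := hx c
    obtain ⟨j, hj, hj'⟩ := hy c
    exact ⟨i + j, I.add_mem hi hj, by rw [map_add, hi', hj', mul_add, mul_add]⟩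
  · intro d x _ hx c
    simpa [mul_assoc] using hx (c * d)

theorem exists_mem_comap_add_mul_eq_one (hm : ∀ o, ∃ r, φ r = m * o) {J : Ideal O}
    (hJ : ∃ a ∈ J, ∃ b : O, a + b * m = 1) : ∃ y ∈ J.comap φ, ∃ r : R, y + r * m = 1 := by
  obtain ⟨a, ha, b, hab⟩ := hJ
  -- The square leaves a spare factor `m`: one brings the coefficient `v` down to `R`, the other
  -- remains in the relation over `R`.
  have h1 : IsCoprime a ((m : O) ^ 2) := .pow_right ⟨1, b, by rw [one_mul, hab]⟩
  obtain ⟨u, v, huv⟩ := h1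
  obtain ⟨r, hr⟩ := hm v
  refine ⟨1 - r * m, ?_, r, by ring⟩
  rw [Ideal.mem_comap, map_sub, map_one, map_mul, hr, map_natCast, ← huv]
  have : u * a + v * (m : O) ^ 2 - m * v * m = u * a := by ring
  rw [this]
  exact J.mul_mem_left _ ha

/-- Modulo `J` the integer `m` is invertible with inverse coming from `R`; since `m o` comes from
`R`, so does the class of `o`. -/
theorem quotientMap_comap_bijective (hm : ∀ o, ∃ r, φ r = m * o) {J : Ideal O}
    (hJ : ∃ a ∈ J, ∃ b : O, a + b * m = 1) :
    Function.Bijective (Ideal.quotientMap J φ le_rfl : R ⧸ J.comap φ →+* O ⧸ J) := by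
  refine ⟨Ideal.quotientMap_injective, fun o ↦ ?_⟩
  obtain ⟨o, rfl⟩ := Ideal.Quotient.mk_surjective o
  obtain ⟨y, hy, r, hry⟩ := exists_mem_comap_add_mul_eq_one hm hJ
  obtain ⟨z, hz⟩ := hm o
  refine ⟨Ideal.Quotient.mk _ (r * z), ?_⟩
  rw [Ideal.quotientMap_mk, Ideal.Quotient.mk_eq_mk_iff_sub_mem, map_mul, hz]
  have h1 : φ y + φ r * m = 1 := by rw [← map_natCast φ, ← map_mul, ← map_add, hry, map_one]
  have h2 : φ r * (m * o) - o = -o * φ y := by linear_combination o * h1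
  rw [h2]
  exact J.mul_mem_left _ hy

theorem map_comap_eq_of_coprime (hm : ∀ o, ∃ r, φ r = m * o) {J : Ideal O}
    (hJ : ∃ a ∈ J, ∃ b : O, a + b * m = 1) : (J.comap φ).map φ = J := by
  refine le_antisymm Ideal.map_comap_le fun j hj ↦ ?_
  obtain ⟨y, hy, r, hry⟩ := exists_mem_comap_add_mul_eq_one hm hJ
  obtain ⟨z, hz⟩ := hm j
  have h1 : φ y + φ r * m = 1 := by rw [← map_natCast φ, ← map_mul, ← map_add, hry, map_one]
  have h2 : j = j * φ y + φ r * φ z := by rw [hz]; linear_combination -j * h1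
  rw [h2]
  refine Ideal.add_mem _ (Ideal.mul_mem_left _ _ (Ideal.mem_map_of_mem φ hy))
    (Ideal.mul_mem_left _ _ (Ideal.mem_map_of_mem φ ?_))
  rw [Ideal.mem_comap, hz]
  exact J.mul_mem_left _ hj

theorem comap_map_eq_of_coprime (hφ : Function.Injective φ) (hm : ∀ o, ∃ r, φ r = m * o)
    {I : Ideal R} (hI : ∃ a ∈ I, ∃ b : R, a + b * m = 1) : (I.map φ).comap φ = I := by
  refine le_antisymm (fun x hx ↦ ?_) Ideal.le_comap_map
  obtain ⟨a, ha, b, hab⟩ := hI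
  obtain ⟨i, hi, hix⟩ := exists_mem_map_eq_natCast_mul hm (Ideal.mem_comap.1 hx)
  rw [← map_natCast φ, ← map_mul] at hix
  rw [← one_mul x, ← hab, add_mul, mul_assoc, ← hφ hix]
  exact I.add_mem (I.mul_mem_right _ ha) (I.mul_mem_left _ hi)

/-- Contraction of the ideals coprime to `m` along an inclusion of rings `φ : R → O` with
`m O ⊆ φ(R)`. -/
noncomputable def coprimeIdealsEquiv (hφ : Function.Injective φ) (hm : ∀ o, ∃ r, φ r = m * o) :
    coprimeIdeals O m ≃ coprimeIdeals R m where
  toFun J := ⟨J.1.comap φ, by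
    have := J.2.1
    exact .of_injective _ (quotientMap_comap_bijective hm J.2.2).1,
    exists_mem_comap_add_mul_eq_one hm J.2.2⟩
  invFun I := ⟨I.1.map φ, by
    have hJ : ∃ a ∈ I.1.map φ, ∃ b : O, a + b * m = 1 := by
      obtain ⟨a, ha, b, hab⟩ := I.2.2
      exact ⟨φ a, Ideal.mem_map_of_mem φ ha, φ b, by
        rw [← map_natCast φ, ← map_mul, ← map_add, hab, map_one]⟩
    have : Finite (R ⧸ (I.1.map φ).comap φ) := by
      rw [comap_map_eq_of_coprime hφ hm I.2.2]
      exact I.2.1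
    exact ⟨.of_surjective _ (quotientMap_comap_bijective hm hJ).2, hJ⟩⟩
  left_inv J := Subtype.ext (map_comap_eq_of_coprime hm J.2.2)
  right_inv I := Subtype.ext (comap_map_eq_of_coprime hφ hm I.2.2)

theorem idealIndex_coprimeIdealsEquiv (hφ : Function.Injective φ) (hm : ∀ o, ∃ r, φ r = m * o)
    (J : coprimeIdeals O m) : idealIndex (coprimeIdealsEquiv hφ hm J).1 = idealIndex J.1 :=
  Nat.card_congr (Equiv.ofBijective _ (quotientMap_comap_bijective hm J.2.2))

/-- Representatives of `O / R` together with `R` exhaust `O`. This yields both the finiteness of `O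
/ IO` and the bound `[O : IO] ≤ [R : I] [O : R]`. -/
theorem surjective_quotient_prod (I : Ideal R) :
    Function.Surjective fun p : (R ⧸ I) × (O ⧸ φ.toAddMonoidHom.range) ↦
      Ideal.quotientMap (I.map φ) φ Ideal.le_comap_map p.1 +
        Ideal.Quotient.mk (I.map φ) (Quotient.out p.2) := by
  intro o
  obtain ⟨o, rfl⟩ := Ideal.Quotient.mk_surjective o
  obtain ⟨r, hr⟩ : ∃ r, φ r = -(Quotient.out (QuotientAddGroup.mk o : O ⧸ φ.toAddMonoidHom.range)) + o := by
    have := QuotientAddGroup.eq.1 (Quotient.out_eq (QuotientAddGroup.mk o : O ⧸ φ.toAddMonoidHom.range))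
    exact this
  refine ⟨(Ideal.Quotient.mk I r, QuotientAddGroup.mk o), ?_⟩
  dsimp only
  rw [Ideal.quotientMap_mk, ← map_add, hr]
  congr 1
  abel

/-- Ideals containing a power of `m` form a negligible set in `R` if they do so in an overring `O`
of finite index. -/
theorem IsNormNegligible.smoothIdeals_of_injective [Module.Free ℤ O] [Module.Finite ℤ O]
    (hφ : Function.Injective φ)
    (hm : ∀ o, ∃ r, φ r = m * o) (hm0 : m ≠ 0) (hfin : Finite (O ⧸ φ.toAddMonoidHom.range))
    (hO : IsNormNegligible fun J : smoothIdeals O m ↦ idealIndex J.1) :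
    IsNormNegligible fun I : smoothIdeals R m ↦ idealIndex I.1 := by
  have : NeZero m := ⟨hm0⟩
  let e : ∀ J : Ideal O, J ≃ₗ[ℤ] (Fin (Module.finrank ℤ (J.restrictScalars ℤ)) → ℤ) := fun J ↦
    (Module.finBasis ℤ (J.restrictScalars ℤ)).equivFun
  -- A finite set recording the image of `I` in `IO / m IO`, in coordinates given by a basis of
  -- `IO`, whose rank is at most that of `O`.
  let T := Σ n : Fin (Module.finrank ℤ O + 1), Set (Fin n → ZMod m)
  let G : Ideal O → Ideal R → T := fun J I ↦
    ⟨⟨Module.finrank ℤ (J.restrictScalars ℤ), Nat.lt_succ_of_le (Submodule.finrank_le _)⟩,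
      {v | ∃ x ∈ I, ∃ hx : φ x ∈ J, v = fun i ↦ (e J ⟨φ x, hx⟩ i : ZMod m)}⟩
  -- Since `m · IO ⊆ I`, the ideal is a union of cosets of `m · IO`, so `IO` and the recorded image
  -- determine it.
  have hG : ∀ J I I', J = I.map φ → J = I'.map φ → G J I = G J I' → I ≤ I' := by
    intro J I I' hI hI' h x hx
    have hset := sigma_mk_injective h
    have hxJ : φ x ∈ J := hI ▸ Ideal.mem_map_of_mem φ hx
    obtain ⟨y, hy, hyJ, hxy⟩ := hset.le ⟨x, hx, hxJ, rfl⟩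
    have hdvd : ∀ i, ∃ c : ℤ, e J (⟨φ x, hxJ⟩ - ⟨φ y, hyJ⟩) i = m * c := fun i ↦ by
      rw [map_sub, Pi.sub_apply]
      exact (ZMod.intCast_eq_intCast_iff_dvd_sub _ _ m).1 (congrFun hxy i).symm
    choose c hc using hdvd
    have h1 : (⟨φ x, hxJ⟩ - ⟨φ y, hyJ⟩ : J) = (m : ℤ) • (e J).symm c := by
      apply (e J).injective
      rw [map_smul, LinearEquiv.apply_symm_apply]
      exact funext hc
    have h2 : φ x - φ y = m * ((e J).symm c : O) := by
      simpa using congrArg Subtype.val h1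
    obtain ⟨i, hi, hi'⟩ := exists_mem_map_eq_natCast_mul hm (hI'.le ((e J).symm c).2)
    rw [← hi', ← map_sub] at h2
    rw [← sub_add_cancel x y, hφ h2]
    exact I'.add_mem hi hy
  let F : smoothIdeals R m → smoothIdeals O m × T := fun I ↦
    (⟨I.1.map φ, by
      have := I.2.1
      exact .of_surjective _ (surjective_quotient_prod I.1), by
      obtain ⟨k, hk⟩ := I.2.2
      exact ⟨k, by simpa using Ideal.mem_map_of_mem φ hk⟩⟩, G (I.1.map φ) I.1)
  have hT : IsNormNegligible fun _ : T ↦ 1 := ⟨fun _ ↦ one_pos, fun _ _ ↦ .of_finite⟩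
  have hF : Function.Injective F := by
    intro I I' h
    have h1 : I.1.map φ = I'.1.map φ := congrArg (fun p ↦ p.1.1) h
    have h2 : G (I.1.map φ) I.1 = G (I'.1.map φ) I'.1 := congrArg (fun p ↦ p.2) h
    rw [← h1] at h2
    exact Subtype.ext (le_antisymm (hG _ _ _ rfl h1 h2) (hG _ _ _ h1 rfl h2.symm))
  refine (hO.prod hT).of_injective hF (fun I ↦ idealIndex_pos I.2.1)
    (m := Nat.card (O ⧸ φ.toAddMonoidHom.range)) Nat.card_pos fun I ↦ ?_
  have := I.2.1
  rw [mul_one, mul_comm, idealIndex, idealIndex, ← Nat.card_prod]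
  exact Nat.card_le_card_of_surjective _ (surjective_quotient_prod I.1)

end OrderTransfer

/-! ### Ideals of a finite product of rings. -/

section PiIdeals

variable {n : ℕ} {O : Fin n → Type} [∀ i, CommRing (O i)] {m : ℕ}

theorem exists_bijective_quotient_pi (I : ∀ i, Ideal (O i)) :
    ∃ f : (∀ i, O i) ⧸ Ideal.pi I → ∀ i, O i ⧸ I i, Function.Bijective f := by
  let f : (∀ i, O i) →+* ∀ i, O i ⧸ I i := RingHom.pi fun i ↦ (Ideal.Quotient.mk (I i)).comp
    (Pi.evalRingHom O i)
  have hker : ∀ x, f x = 0 ↔ x ∈ Ideal.pi I := fun x ↦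
    funext_iff.trans (forall_congr' fun i ↦ Ideal.Quotient.eq_zero_iff_mem)
  refine ⟨Ideal.Quotient.lift (Ideal.pi I) f fun x hx ↦ (hker x).2 hx, ?_, ?_⟩
  · rw [injective_iff_map_eq_zero]
    intro x hx
    obtain ⟨x, rfl⟩ := Ideal.Quotient.mk_surjective x
    rw [Ideal.Quotient.lift_mk, hker] at hx
    exact Ideal.Quotient.eq_zero_iff_mem.2 hx
  · intro y
    choose x hx using fun i ↦ Ideal.Quotient.mk_surjective (y i)
    exact ⟨Ideal.Quotient.mk _ x, by rw [Ideal.Quotient.lift_mk]; exact funext hx⟩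

theorem idealIndex_pi (I : ∀ i, Ideal (O i)) : idealIndex (Ideal.pi I) = ∏ i, idealIndex (I i) := by
  obtain ⟨f, hf⟩ := exists_bijective_quotient_pi I
  rw [idealIndex, Nat.card_congr (Equiv.ofBijective f hf), Nat.card_pi]
  rfl

theorem finite_quotient_pi_iff (I : ∀ i, Ideal (O i)) :
    Finite ((∀ i, O i) ⧸ Ideal.pi I) ↔ ∀ i, Finite (O i ⧸ I i) := by
  obtain ⟨f, hf⟩ := exists_bijective_quotient_pi I
  rw [(Equiv.ofBijective f hf).finite_iff]
  exact ⟨fun h i ↦ .of_surjective (fun x : ∀ i, O i ⧸ I i ↦ x i)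
    (Function.surjective_eval i), fun h ↦ inferInstance⟩

theorem pi_mem_smoothIdeals_iff (I : ∀ i, Ideal (O i)) :
    Ideal.pi I ∈ smoothIdeals (∀ i, O i) m ↔ ∀ i, I i ∈ smoothIdeals (O i) m := by
  simp only [smoothIdeals, Set.mem_ofPred_eq, finite_quotient_pi_iff, forall_and]
  refine and_congr_right fun _ ↦ ⟨fun ⟨k, hk⟩ i ↦ ⟨k, hk i⟩, fun h ↦ ?_⟩
  choose k hk using h
  exact ⟨∑ i, k i, fun i ↦ (I i).pow_mem_of_pow_mem (hk i)
    (Finset.single_le_sum (fun _ _ ↦ Nat.zero_le _) (Finset.mem_univ i))⟩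

theorem pi_mem_coprimeIdeals_iff (I : ∀ i, Ideal (O i)) :
    Ideal.pi I ∈ coprimeIdeals (∀ i, O i) m ↔ ∀ i, I i ∈ coprimeIdeals (O i) m := by
  simp only [coprimeIdeals, Set.mem_ofPred_eq, finite_quotient_pi_iff, forall_and]
  refine and_congr_right fun _ ↦ ⟨fun ⟨a, ha, b, h⟩ i ↦ ⟨a i, ha i, b i, congrFun h i⟩, fun h ↦ ?_⟩
  choose a ha b hab using h
  exact ⟨a, ha, b, funext hab⟩

/-- Ideals of a finite product with all components in given classes. -/
def piSubtypeEquiv {p : ∀ i, Ideal (O i) → Prop} {q : Ideal (∀ i, O i) → Prop}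
    (h : ∀ I : ∀ i, Ideal (O i), q (Ideal.pi I) ↔ ∀ i, p i (I i)) :
    (∀ i, {I // p i I}) ≃ {J // q J} :=
  Equiv.subtypePiEquivPi.symm.trans
    (Ideal.piOrderIso.symm.toEquiv.subtypeEquiv fun I ↦ (h I).symm)

theorem isNormNegligible_smoothIdeals_pi
    (h : ∀ i, IsNormNegligible fun I : smoothIdeals (O i) m ↦ idealIndex I.1) :
    IsNormNegligible fun J : smoothIdeals (∀ i, O i) m ↦ idealIndex J.1 :=
  (IsNormNegligible.pi h).of_equiv (piSubtypeEquiv pi_mem_smoothIdeals_iff) fun I ↦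
    idealIndex_pi fun i ↦ (I i).1

end PiIdeals

theorem hasZetaPole_coprimeIdeals_pi {n m : ℕ} {O : Fin (n + 1) → Type} [∀ i, CommRing (O i)]
    (h : ∀ i, HasZetaPole (fun I : coprimeIdeals (O i) m ↦ idealIndex I.1) 0) :
    HasZetaPole (fun J : coprimeIdeals (∀ i, O i) m ↦ idealIndex J.1) n :=
  (HasZetaPole.pi h).of_equiv (piSubtypeEquiv pi_mem_coprimeIdeals_iff) fun I ↦
    idealIndex_pi fun i ↦ (I i).1

/-! ### `ℤ[X]/(f)` as a subring of finite index in a product of rings of integers. -/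

section OrdersInNumberFields

open NumberField

/-- Evaluation at a root of `g` in `ℚ[X]/(g)`, which is integral because `g` is monic. Gauss's lemma
descends divisibility by `g` from `ℚ` to `ℤ` and so identifies the kernel. -/
theorem exists_ringHom_ringOfIntegers {g : ℤ[X]} (hg : g.Monic) (hirr : Irreducible g) :
    ∃ (K : Type) (_ : Field K) (_ : NumberField K) (ψ : ℤ[X] →+* 𝓞 K),
      (∀ p, ψ p = 0 ↔ g ∣ p) ∧ Module.finrank ℤ (𝓞 K) = g.natDegree := by
  have : Fact (Irreducible (g.map (algebraMap ℤ ℚ))) :=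
    ⟨(hg.irreducible_iff_irreducible_map_fraction_map (K := ℚ)).1 hirr⟩
  let K := AdjoinRoot (g.map (algebraMap ℤ ℚ))
  have hroot : IsIntegral ℤ (AdjoinRoot.root (g.map (algebraMap ℤ ℚ))) := by
    refine ⟨g, hg, ?_⟩
    have h := AdjoinRoot.eval₂_root (g.map (algebraMap ℤ ℚ))
    rw [eval₂_map] at h
    rwa [RingHom.ext_int (algebraMap ℤ (AdjoinRoot (g.map (algebraMap ℤ ℚ)))) _]
  let α : 𝓞 K := ⟨_, hroot⟩
  refine ⟨K, inferInstance, inferInstance, (aeval α).toRingHom, fun p ↦ ?_, ?_⟩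
  · have h1 : ((aeval α p : 𝓞 K) : K) = AdjoinRoot.mk _ (p.map (algebraMap ℤ ℚ)) := by
      rw [← AdjoinRoot.aeval_eq, aeval_map_algebraMap]
      exact (aeval_algebraMap_apply K α p).symm
    rw [IsPrimitive.Int.dvd_iff_map_cast_dvd_map_cast _ _ hg.isPrimitive]
    change aeval α p = 0 ↔ _
    exact RingOfIntegers.coe_eq_zero_iff.symm.trans
      ((congrArg (· = 0) h1).to_iff.trans AdjoinRoot.mk_eq_zero)
  · rw [RingOfIntegers.rank, ← hg.natDegree_map (algebraMap ℤ ℚ)]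
    exact finrank_quotient_span_eq_natDegree

theorem isRelPrime_of_monic_of_irreducible {p q : ℤ[X]} (hp : p.Monic) (hq : q.Monic)
    (hpi : Irreducible p) (hqi : Irreducible q) (h : p ≠ q) : IsRelPrime p q := by
  rw [hpi.isRelPrime_iff_not_dvd]
  exact fun hd ↦ h (eq_of_monic_of_associated hp hq (hpi.associated_of_dvd hqi hd))

/-- A product of distinct monic irreducible polynomials `f` embeds `ℤ[X]/(f)` as a subring of finite
index in a product of rings of integers. -/
theorem exists_injective_pi_ringOfIntegers {k : ℕ} {f : ℤ[X]} {g : Fin k → ℤ[X]}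
    (hmonic : ∀ i, (g i).Monic) (hirr : ∀ i, Irreducible (g i))
    (hdistinct : Function.Injective g) (hfg : f = ∏ i, g i) :
    ∃ (K : Fin k → Type) (_ : ∀ i, Field (K i)) (_ : ∀ i, NumberField (K i))
      (φ : ℤ[X] ⧸ Ideal.span {f} →+* ∀ i, 𝓞 (K i)), Function.Injective φ ∧
      Finite ((∀ i, 𝓞 (K i)) ⧸ φ.toAddMonoidHom.range) := by
  choose K _ _ ψ hψ hrank using fun i ↦ exists_ringHom_ringOfIntegers (hmonic i) (hirr i)
  have hf : f.Monic := hfg ▸ monic_prod_of_monic _ _ fun i _ ↦ hmonic i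
  have hker : ∀ p, RingHom.pi ψ p = 0 ↔ f ∣ p := fun p ↦ by
    refine (funext_iff.trans (forall_congr' fun i ↦ hψ i p)).trans ?_
    rw [hfg]
    refine ⟨fun h ↦ Fintype.prod_dvd_of_isRelPrime (fun i j hij ↦ ?_) h,
      fun h i ↦ (Finset.dvd_prod_of_mem g (Finset.mem_univ i)).trans h⟩
    exact isRelPrime_of_monic_of_irreducible (hmonic i) (hmonic j) (hirr i) (hirr j)
      (hdistinct.ne hij)
  let φ : ℤ[X] ⧸ Ideal.span {f} →+* ∀ i, 𝓞 (K i) := Ideal.Quotient.lift _ (RingHom.pi ψ)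
    fun p hp ↦ (hker p).2 (Ideal.mem_span_singleton.1 hp)
  have hφ : Function.Injective φ := by
    rw [injective_iff_map_eq_zero]
    intro x hx
    obtain ⟨x, rfl⟩ := Ideal.Quotient.mk_surjective x
    rw [Ideal.Quotient.lift_mk, hker] at hx
    exact Ideal.Quotient.eq_zero_iff_mem.2 (Ideal.mem_span_singleton.2 hx)
  refine ⟨K, inferInstance, inferInstance, φ, hφ, ?_⟩
  -- Source and target are free of rank `deg f = ∑ deg g_i`, so an injective map has finite
  -- cokernel.
  let L : ℤ[X] ⧸ Ideal.span {f} →ₗ[ℤ] ∀ i, 𝓞 (K i) := φ.toAddMonoidHom.toIntLinearMap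
  refine Submodule.finiteQuotientOfFreeOfRankEq (LinearMap.range L) ?_
  rw [LinearMap.finrank_range_of_inj hφ, finrank_quotient_span_eq_natDegree' hf,
    Module.finrank_pi_fintype, hfg, natDegree_prod_of_monic _ _ fun i _ ↦ hmonic i]
  exact Finset.sum_congr rfl fun i _ ↦ (hrank i).symm

theorem hasZetaPole_idealIndex_quotient {n : ℕ} {f : ℤ[X]} {g : Fin (n + 1) → ℤ[X]}
    (hmonic : ∀ i, (g i).Monic) (hirr : ∀ i, Irreducible (g i))
    (hdistinct : Function.Injective g) (hfg : f = ∏ i, g i) :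
    HasZetaPole (fun I : FiniteIndexIdeal (ℤ[X] ⧸ Ideal.span {f}) ↦ idealIndex I.1) n := by
  obtain ⟨K, _, _, φ, hφ, hfin⟩ := exists_injective_pi_ringOfIntegers hmonic hirr hdistinct hfg
  -- The index of the image annihilates the additive quotient, so `m O` lies in the image.
  let m := Nat.card ((∀ i, 𝓞 (K i)) ⧸ φ.toAddMonoidHom.range)
  have hm0 : m ≠ 0 := Nat.card_pos.ne'
  have hm : ∀ o, ∃ r, φ r = m * o := fun o ↦ by
    obtain ⟨r, hr⟩ := AddSubgroup.nsmul_index_mem φ.toAddMonoidHom.range o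
    exact ⟨r, by rw [← nsmul_eq_mul]; exact hr⟩
  have hsmooth := (isNormNegligible_smoothIdeals_pi fun i ↦
    isNormNegligible_smoothIdeals (K i) hm0).smoothIdeals_of_injective hφ hm hm0 hfin
  have hcoprime : HasZetaPole (fun I : coprimeIdeals (ℤ[X] ⧸ Ideal.span {f}) m ↦ idealIndex I.1) n :=
    (hasZetaPole_coprimeIdeals_pi fun i ↦
    hasZetaPole_coprimeIdeals (K i) hm0).of_equiv (coprimeIdealsEquiv hφ hm)
    (idealIndex_coprimeIdealsEquiv hφ hm)
  -- The unit ideal contains `m ^ 0`; this makes the negligible factor nonzero at `1`.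
  have : Nonempty (smoothIdeals (ℤ[X] ⧸ Ideal.span {f}) m) :=
    ⟨⟨⊤, inferInstance, 0, Submodule.mem_top⟩⟩
  exact (hcoprime.prod_negligible hsmooth).of_equiv ((Equiv.prodComm _ _).trans
    (smoothCoprimeEquiv _ m)) fun p ↦ by
      rw [mul_comm]
      exact idealIndex_smoothCoprimeEquiv m p.swap

end OrdersInNumberFields

/-! ### Translation to the numbers of ideals of given index. -/

section IdealCount

open Filter Topology

variable {R : Type*} [CommRing R]

theorem idealIndex_ne_zero_iff {I : Ideal R} : idealIndex I ≠ 0 ↔ Finite (R ⧸ I) := by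
  rw [idealIndex, Nat.card_ne_zero]
  exact and_iff_right ⟨0⟩

theorem HasZetaPole.finite_idealsOfIndex {j : ℕ}
    (h : HasZetaPole (fun I : FiniteIndexIdeal R ↦ idealIndex I.1) j) {n : ℕ} (hn : 1 ≤ n) :
    (idealsOfIndex R n).Finite := by
  refine ((h.finite n).image Subtype.val).subset fun I hI ↦ ?_
  have hI : idealIndex I = n := hI
  have hfin : Finite (R ⧸ I) := idealIndex_ne_zero_iff.1 (by lia)
  exact ⟨⟨I, hfin⟩, by exact_mod_cast hI.le, rfl⟩

theorem HasZetaPole.idealCountLE_eq {j : ℕ}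
    (h : HasZetaPole (fun I : FiniteIndexIdeal R ↦ idealIndex I.1) j) (N : ℕ) :
    idealCountLE R N = normCount (fun I : FiniteIndexIdeal R ↦ idealIndex I.1) N := by
  classical
  let e : {I : FiniteIndexIdeal R // (idealIndex I.1 : ℝ) ≤ N} ≃
      Σ n : Finset.Icc 1 N, idealsOfIndex R n :=
    { toFun I := ⟨⟨idealIndex I.1.1, Finset.mem_Icc.2 ⟨h.pos I.1, by exact_mod_cast I.2⟩⟩, I.1.1, rfl⟩
      invFun p := ⟨⟨p.2.1, idealIndex_ne_zero_iff.1 (by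
        have h1 : idealIndex p.2.1 = p.1 := p.2.2
        have h2 := Finset.mem_Icc.1 p.1.2
        lia)⟩, by
        have h1 : idealIndex p.2.1 = p.1 := p.2.2
        have h2 := Finset.mem_Icc.1 p.1.2
        exact_mod_cast h1.trans_le h2.2⟩
      left_inv _ := rfl
      right_inv := by
        rintro ⟨⟨n, hn⟩, I, hI : idealIndex I = n⟩
        subst hI
        rfl }
  have : ∀ n : Finset.Icc 1 N, Finite (idealsOfIndex R n) := fun n ↦
    h.finite_idealsOfIndex (Finset.mem_Icc.1 n.2).1
  rw [normCount, Nat.card_congr e, Nat.card_sigma, idealCountLE, ← Finset.sum_coe_sort]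
  rfl

theorem HasZetaPole.isEquivalent_idealCountLE {j : ℕ}
    (h : HasZetaPole (fun I : FiniteIndexIdeal R ↦ idealIndex I.1) j) :
    ∃ c : ℝ, 0 < c ∧ Asymptotics.IsEquivalent atTop (fun N : ℕ ↦ (idealCountLE R N : ℝ))
      fun N : ℕ ↦ c * (N : ℝ) * Real.log (N : ℝ) ^ j := by
  obtain ⟨c, hc, hlim⟩ := h.asymptotic
  refine ⟨c, hc, ?_⟩
  have hlim := hlim.comp tendsto_natCast_atTop_atTop
  have hpos : ∀ᶠ N : ℕ in atTop, 0 < (N : ℝ) * Real.log N ^ j := by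
    filter_upwards [eventually_ge_atTop 2] with N hN
    have : (1 : ℝ) < N := by exact_mod_cast hN
    have := Real.log_pos this
    positivity
  rw [Asymptotics.isEquivalent_iff_tendsto_one]
  · have h1 := hlim.div_const c
    rw [div_self hc.ne'] at h1
    refine h1.congr fun N ↦ ?_
    simp only [Function.comp_apply, Pi.div_apply, h.idealCountLE_eq]
    rw [div_div, mul_comm _ c, mul_assoc]
  · filter_upwards [hpos] with N hN
    rw [mul_assoc]
    exact (mul_pos hc hN).ne'

end IdealCount

theorem theorem2p3 (k : ℕ) (hk : 1 ≤ k) (f : ℤ[X]) (hf : f.Monic)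
    (g : Fin k → ℤ[X]) (hmonic : ∀ i, (g i).Monic) (hirr : ∀ i, Irreducible (g i))
    (hdistinct : Function.Injective g) (hfg : f = ∏ i, g i) :
    -- the zeta function converges for `Re s > 1`
    (∀ s : ℂ, 1 < s.re → Summable (idealZetaTerm (ℤ[X] ⧸ Ideal.span {f}) s)) ∧
    -- it extends meromorphically to `Re s > 0`, with a pole of order `k` at `s = 1`
    (∃ F : ℂ → ℂ, MeromorphicOn F {s : ℂ | 0 < s.re} ∧
      (∀ s : ℂ, 1 < s.re → F s = idealZeta (ℤ[X] ⧸ Ideal.span {f}) s) ∧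
      meromorphicOrderAt F 1 = ((-(k : ℤ) : ℤ) : WithTop ℤ)) ∧
    -- the numbers of ideals are finite, with the stated asymptotics
    (∀ n : ℕ, 1 ≤ n → (idealsOfIndex (ℤ[X] ⧸ Ideal.span {f}) n).Finite) ∧
    (∃ c : ℝ, 0 < c ∧
      Asymptotics.IsEquivalent Filter.atTop
        (fun N : ℕ => (idealCountLE (ℤ[X] ⧸ Ideal.span {f}) N : ℝ))
        (fun N : ℕ => c * (N : ℝ) * (Real.log (N : ℝ)) ^ (k - 1))) := by
  -- With `k = n + 1`, the index `n` encodes both the pole order `k` and the logarithmic exponent `k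
  -- - 1`.
  obtain ⟨n, rfl⟩ := Nat.exists_eq_add_of_le' hk
  have h := hasZetaPole_idealIndex_quotient hmonic hirr hdistinct hfg
  exact ⟨h.summable, h.continuation, fun _ ↦ h.finite_idealsOfIndex, h.isEquivalent_idealCountLE⟩
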